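/- Throughout, a space $X$ is a locally noetherian Grothendieck category $\operatorname{Mod}X$ (a Grothendieck category with a set of noetherian generators), whose objects are called modules and whose subobjects are called submodules. A dimension function on $X$ is a function $\dim$ from modules to ordinals together with an extra least value $-1$ such that: $\dim M=-1$ iff $M=0$; $\dim N=\max\{\dim M,\dim K\}$ for each short exact sequence $0\to M\to N\to K\to 0$; $\dim N=\sup\{\dim N' : N'\le N \text{ noetherian}\}$; and for each strictly descending chain $M=M_0\supset M_1\supset\cdots$ with $M$ noetherian, $\dim M_i/M_{i+1}<\dim M$ for all but finitely many $i$. For an ordinal $\alpha$ put $\mathcal C_{<\alpha}=\{M:\dim M<\alpha\}$, a Serre subcategory, with quotient functor $\pi_\alpha:X\to X/\mathcal C_{<\alpha}$. A module $M$ is $\alpha$-critical if $\dim M=\alpha$ and $\dim M/N<\alpha$ for every nonzero $N\le M$; critical means $\alpha$-critical for some ordinal $\alpha$. An $\alpha$-critical module $M$ is tiny if for every noetherian object $\mathcal N$ of $X/\mathcal C_{<\alpha}$, $\operatorname{Hom}(\mathcal N,\pi_\alpha M)$ is finitely generated over $\operatorname{End}(\pi_\alpha M)$. Fix a dimension function on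 $X$ such that $\mathcal C_{<\alpha}$ is localizing (closed under direct sums) for every $\alpha$ for which an $\alpha$-critical module exists. A weakly closed subspace $Z$ of $X$ is a full subcategory $\operatorname{Mod}Z$ of $\operatorname{Mod}X$ closed under subobjects, quotients and direct sums; it is closed if it is also closed under products. It carries the restricted dimension function; $i:Z\to X$ denotes the inclusion. $\sigma[M]$ (resp. $\pi[M]$) is the smallest weakly closed (resp. closed) subspace containing $M$. The saturation $\operatorname{Mod}_ZX$ consists of the modules $M$ having an exhaustive filtration $0=F_0\le F_1\le F_2\le\cdots$, $\bigcup_n F_n=M$, with all $F_{n+1}/F_n$ in $\operatorname{Mod}Z$. For an indecomposable injective $E$, let $\tilde{\mathcal O}$ be its largest critical submodule. A weak point of $X$ is a subspace of the form $W=\sigma[\tilde{\mathcal O}]$ for some indecomposable injective $E$; it is a point if $\tilde{\mathcal O}$ is tiny for some such $E$. Weak points and points of a weakly closed subspace $Z$ are defined in the same way inside $\operatorname{Mod}Z$. If $W=\sigma[\tilde{\mathcal O}]$ is a weak point of $Z$, its extension $W|^X$ is $\sigma[\tilde M]$, where $\tilde M$ is the largest critical submodule of an injective hull in $\operatorname{Mod}X$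 of $M=i_*\tilde{\mathcal O}$. **Theorem.** (1) Let $i:Z\to X$ be the inclusion of a weakly closed subspace with $\operatorname{Mod}_ZX=X$, and let $W$ be a weak point of $Z$. Then $W$ is a point of $Z$ if and only if $W|^X$ is a point of $X$. (2) Call a nonzero module $M$ prime if $\pi[M]=\pi[N]$ for all nonzero $N\le M$, and let $X_{\rm red}$ be the smallest closed subspace of $X$ containing all prime modules. If $X$ has enough prime modules (every nonzero module has a prime submodule), then $\operatorname{Mod}_{X_{\rm red}}X=X$; consequently, a weak point $W$ of $X_{\rm red}$ is a point of $X_{\rm red}$ if and only if $W|^X$ is a point of $X$. -/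

import Mathlib

open CategoryTheory CategoryTheory.Limits

universe t v u

namespace NCSpace

section Subspaces

variable {C : Type u} [Category.{v} C]

/-- A category is locally noetherian if it has a (small) set of noetherian generators. -/
def IsLocallyNoetherian (C : Type u) [Category.{v} C] : Prop :=
  ∃ (ι : Type v) (G : ι → C), (∀ i, IsNoetherianObject (G i)) ∧
    (ObjectProperty.ofObj G).IsSeparating

/-- A weakly closed subspace of `C`, given by the objects of a full subcategory:
it is closed under subobjects, quotients (hence isomorphisms) and direct sums. -/
class IsWeaklyClosed (P : ObjectProperty C) : Prop
    extends P.IsClosedUnderSubobjects, P.IsClosedUnderQuotients where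
  closedUnderCoproducts (ι : Type v) : P.IsClosedUnderColimitsOfShape (Discrete ι)

/-- A closed subspace is a weakly closed subspace which is also closed under products. -/
class IsClosedSubspace (P : ObjectProperty C) : Prop extends IsWeaklyClosed P where
  closedUnderProducts (ι : Type v) : P.IsClosedUnderLimitsOfShape (Discrete ι)

/-- `σ[M]`: the smallest weakly closed subspace containing `M`. -/
def sigma (M : C) : ObjectProperty C :=
  fun N => ∀ P : ObjectProperty C, IsWeaklyClosed P → P M → P N

/-- The smallest closed subspace containing all objects satisfying `S`. -/
def closedSpan (S : ObjectProperty C) : ObjectProperty C :=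
  fun N => ∀ P : ObjectProperty C, IsClosedSubspace P → S ≤ P → P N

/-- `π[M]`: the smallest closed subspace containing `M`. -/
def pi (M : C) : ObjectProperty C := closedSpan (fun N => N = M)

instance sigma_isWeaklyClosed (M : C) : IsWeaklyClosed (sigma M) where
  prop_of_mono f _ h P hP hM := P.prop_of_mono f (h P hP hM)
  prop_of_epi f _ h P hP hM := P.prop_of_epi f (h P hP hM)
  closedUnderCoproducts ι := ⟨by
    rintro N ⟨⟨F, c, hc⟩, hF⟩ P hP hM
    have := hP.closedUnderCoproducts ι
    exact P.prop_of_isColimit hc (fun j => hF j P hP hM)⟩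

instance closedSpan_isClosedSubspace (S : ObjectProperty C) :
    IsClosedSubspace (closedSpan S) where
  prop_of_mono f _ h P hP hM := P.prop_of_mono f (h P hP hM)
  prop_of_epi f _ h P hP hM := P.prop_of_epi f (h P hP hM)
  closedUnderCoproducts ι := ⟨by
    rintro N ⟨⟨F, c, hc⟩, hF⟩ P hP hM
    have := hP.closedUnderCoproducts ι
    exact P.prop_of_isColimit hc (fun j => hF j P hP hM)⟩
  closedUnderProducts ι := ⟨by
    rintro N ⟨⟨F, c, hc⟩, hF⟩ P hP hM
    have := hP.closedUnderProducts ι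
    exact P.prop_of_isLimit hc (fun j => hF j P hP hM)⟩

end Subspaces

section Abelian

variable {C : Type u} [Category.{v} C] [Abelian C]

section Subcategory

variable (P : ObjectProperty C) [hP : IsWeaklyClosed P]

instance : P.IsClosedUnderFiniteCoproducts :=
  ObjectProperty.IsClosedUnderFiniteCoproducts.of_isClosedUnderColimitsOfShape
    (fun (J : Type v) _ => hP.closedUnderCoproducts J)

instance : P.ContainsZero where
  exists_zero := ⟨⊥_ C, initialIsInitial.isZero, P.prop_initial⟩

instance : P.IsClosedUnderFiniteProducts where
  isClosedUnderLimitsOfShape J _ := ⟨by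
    rintro N ⟨⟨F, c, hc⟩, hF⟩
    have := Abelian.hasFiniteBiproducts (C := C)
    have hN : P (⨁ fun j => F.obj ⟨j⟩) :=
      P.prop_of_iso (biproduct.isoCoproduct _).symm
        (P.prop_colimit (Discrete.functor fun j => F.obj ⟨j⟩) (fun j => hF j))
    refine P.prop_of_iso ?_ hN
    exact biproduct.isoProduct _ ≪≫ HasLimit.isoOfNatIso (G := F)
      (Discrete.natIso fun _ => Iso.refl _) ≪≫ (limit.isLimit F).conePointUniqueUpToIso hc⟩

instance {M N : P.FullSubcategory} (f : M ⟶ N) [Mono f] : Mono f.hom :=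
  have := P.preservesMonomorphisms_ι_of_isNormalEpiCategory
  inferInstanceAs (Mono (P.ι.map f))

instance {M N : P.FullSubcategory} (f : M ⟶ N) [Epi f] : Epi f.hom :=
  have := P.preservesEpimorphisms_ι_of_isNormalMonoCategory
  inferInstanceAs (Epi (P.ι.map f))

lemma isNoetherianObject_iff (M : P.FullSubcategory) :
    IsNoetherianObject M ↔ IsNoetherianObject M.obj := by
  let T (N : Subobject M.obj) : P.FullSubcategory := ⟨(N : C), P.prop_of_mono N.arrow M.property⟩
  let a (N : Subobject M.obj) : T N ⟶ M := P.homMk N.arrow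
  have ha (N : Subobject M.obj) : Mono (a N) :=
    have : Mono (a N).hom := inferInstanceAs (Mono N.arrow)
    P.ι.mono_of_mono_map (f := a N) this
  simp only [isNoetherianObject_iff_not_strictMono]
  constructor
  · intro h f hf
    refine h (fun n => Subobject.mk (a (f n))) (strictMono_nat_of_lt_succ fun n => ?_)
    have hlt := hf (Nat.lt_succ_self n)
    refine lt_of_le_not_ge ?_ fun hle => hlt.not_ge ?_
    · exact Subobject.mk_le_mk_of_comm (P.homMk (Subobject.ofLE _ _ hlt.le))
        (by ext; exact Subobject.ofLE_arrow _)
    · refine Subobject.le_of_comm (Subobject.ofMkLEMk _ _ hle).hom ?_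
      exact congrArg (fun k => k.hom) (Subobject.ofMkLEMk_comp hle)
  · intro h f hf
    refine h (fun n => Subobject.mk (f n).arrow.hom) (strictMono_nat_of_lt_succ fun n => ?_)
    have hlt := hf (Nat.lt_succ_self n)
    refine lt_of_le_not_ge ?_ fun hle => hlt.not_ge ?_
    · exact Subobject.mk_le_mk_of_comm (Subobject.ofLE _ _ hlt.le).hom
        (congrArg (fun k => k.hom) (Subobject.ofLE_arrow hlt.le))
    · refine Subobject.le_of_comm (P.homMk (Subobject.ofMkLEMk _ _ hle)) ?_
      ext
      exact Subobject.ofMkLEMk_comp hle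

lemma shortExact_map {S : ShortComplex P.FullSubcategory} (hS : S.ShortExact) :
    (S.map P.ι).ShortExact := by
  have := P.preservesKernels_ι
  have hk := hS.fIsKernel
  have := hS.mono_f
  have := hS.epi_g
  have h1 : Mono (S.map P.ι).f := inferInstanceAs (Mono S.f.hom)
  have h2 : Epi (S.map P.ι).g := inferInstanceAs (Epi S.g.hom)
  exact { exact := ShortComplex.exact_of_f_is_kernel _
            (KernelFork.mapIsLimit _ hk P.ι) }

end Subcategory

/-- An exact, finitely partitive dimension function with values in the ordinals, together
with an additional least value `⊥` (playing the role of `-1`). -/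
structure DimensionFunction (C : Type u) [Category.{v} C] [Abelian C] where
  dim : C → WithBot Ordinal.{t}
  dim_eq_bot_iff (M : C) : dim M = ⊥ ↔ IsZero M
  exact (S : ShortComplex C) : S.ShortExact → dim S.X₂ = max (dim S.X₁) (dim S.X₃)
  isLUB_noetherian (N : C) :
    IsLUB {a | ∃ (N' : C) (f : N' ⟶ N), Mono f ∧ IsNoetherianObject N' ∧ dim N' = a} (dim N)
  /-- In a descending chain `M = M₀ ⊃ M₁ ⊃ ⋯` of submodules of a noetherian `M`,
  all but finitely many factors have dimension less than `dim M`. -/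
  finitelyPartitive (M : ℕ → C) (i : ∀ n, M (n + 1) ⟶ M n) :
    (∀ n, Mono (i n) ∧ ¬ IsIso (i n)) → IsNoetherianObject (M 0) →
      ∀ᶠ n in Filter.atTop, dim (cokernel (i n)) < dim (M 0)

namespace DimensionFunction

variable (d : DimensionFunction.{t} C)

lemma dim_le_of_mono {M N : C} (f : M ⟶ N) [Mono f] : d.dim M ≤ d.dim N := by
  have h := d.exact (ShortComplex.mk f (cokernel.π f) (by simp))
    (ShortComplex.ShortExact.mk (ShortComplex.exact_cokernel f))
  exact (le_max_left _ _).trans h.ge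

lemma dim_le_of_epi {M N : C} (f : M ⟶ N) [Epi f] : d.dim N ≤ d.dim M := by
  have h := d.exact (ShortComplex.mk (kernel.ι f) f (by simp))
    (ShortComplex.ShortExact.mk (ShortComplex.exact_kernel f))
  exact (le_max_right _ _).trans h.ge

lemma dim_congr {M N : C} (e : M ≅ N) : d.dim M = d.dim N :=
  le_antisymm (d.dim_le_of_mono e.hom) (d.dim_le_of_mono e.inv)

/-- `C_{<α}`: the objects of dimension less than `α`. -/
def lt (α : Ordinal.{t}) : ObjectProperty C := fun M => d.dim M < (α : WithBot Ordinal.{t})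

instance (α : Ordinal.{t}) : (d.lt α).IsSerreClass where
  exists_zero := ⟨⊥_ C, initialIsInitial.isZero, by
    have := (d.dim_eq_bot_iff (⊥_ C)).2 initialIsInitial.isZero
    simp [lt, this]⟩
  prop_of_mono f _ h := (d.dim_le_of_mono f).trans_lt h
  prop_of_epi f _ h := (d.dim_le_of_epi f).trans_lt h
  prop_X₂_of_shortExact hS h₁ h₃ := by
    have := d.exact _ hS
    simp only [lt] at h₁ h₃ ⊢
    rw [this]
    exact max_lt h₁ h₃

/-- The restriction of a dimension function to a weakly closed subspace. -/
noncomputable def restrict (P : ObjectProperty C) [IsWeaklyClosed P] :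
    DimensionFunction.{t} P.FullSubcategory where
  dim M := d.dim M.obj
  dim_eq_bot_iff M := by
    rw [d.dim_eq_bot_iff]
    simp only [IsZero.iff_id_eq_zero]
    exact ⟨fun h => by ext; exact h, fun h => congrArg (fun k => k.hom) h⟩
  exact S hS := d.exact _ (shortExact_map P hS)
  isLUB_noetherian N := by
    convert d.isLUB_noetherian N.obj using 1
    ext a
    constructor
    · rintro ⟨N', f, hf, hN', rfl⟩
      exact ⟨N'.obj, f.hom, inferInstance, (isNoetherianObject_iff P N').1 hN', rfl⟩
    · rintro ⟨N', f, hf, hN', rfl⟩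
      let N'' : P.FullSubcategory := ⟨N', P.prop_of_mono f N.property⟩
      have : Mono (P.homMk f : N'' ⟶ N).hom := hf
      exact ⟨N'', P.homMk f, P.ι.mono_of_mono_map this, (isNoetherianObject_iff P N'').2 hN', rfl⟩
  finitelyPartitive M i hi hM := by
    have := P.preservesCokernels_ι
    have key := d.finitelyPartitive (fun n => (M n).obj) (fun n => (i n).hom)
      (fun n => ⟨have := (hi n).1; inferInstance, fun h => (hi n).2 (by
        have : IsIso (P.ι.map (i n)) := h
        exact isIso_of_reflects_iso (i n) P.ι)⟩)
      ((isNoetherianObject_iff P (M 0)).1 hM)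
    filter_upwards [key] with n hn
    exact (d.dim_congr (PreservesCokernel.iso P.ι (i n))).trans_lt hn

/-- `M` is `α`-critical: `dim M = α`, and `dim M/N < α` for every nonzero submodule `N`. -/
def IsCriticalOfDim (α : Ordinal.{t}) (M : C) : Prop :=
  d.dim M = (α : WithBot Ordinal.{t}) ∧
    ∀ N : Subobject M, N ≠ ⊥ → d.dim (cokernel N.arrow) < (α : WithBot Ordinal.{t})

/-- `M` is critical: it is `α`-critical for some ordinal `α` (so `M` is nonzero). -/
def IsCritical (M : C) : Prop := ∃ α : Ordinal.{t}, d.IsCriticalOfDim α M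

/-- `O` is the largest critical submodule of `E`. -/
def IsLargestCritical {E : C} (O : Subobject E) : Prop :=
  IsGreatest {N : Subobject E | d.IsCritical (N : C)} O

end DimensionFunction

/-- An object `S` is tiny if `Hom(N, S)` is finitely generated over `End(S)` for every
noetherian object `N`. -/
def IsTinyObject {D : Type*} [Category* D] [Preadditive D] (S : D) : Prop :=
  ∀ N : D, IsNoetherianObject N → Module.Finite (End S) (N ⟶ S)

/-- A localizing subcategory: a Serre class closed under direct sums. -/
class IsLocalizing (T : ObjectProperty C) : Prop extends T.IsSerreClass where
  closedUnderCoproducts (ι : Type v) : T.IsClosedUnderColimitsOfShape (Discrete ι)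

/-- The inclusion `j : M ⟶ E` is an injective hull. -/
structure IsInjectiveHull {M E : C} (j : M ⟶ E) : Prop where
  mono : Mono j
  injective : Injective E
  essential (N : Subobject E) : N ≠ ⊥ → N ⊓ Subobject.mk j ≠ ⊥

namespace DimensionFunction

variable (d : DimensionFunction.{t} C)

/-- A critical object `M` of dimension `α` is tiny if its image in the quotient category
`C / C_{<α}` is tiny (this image is automatically simple). -/
def IsTiny (M : C) : Prop :=
  ∃ α : Ordinal.{t}, d.IsCriticalOfDim α M ∧ IsTinyObject ((d.lt α).isoModSerre.Q.obj M)

/-- `E` is an indecomposable injective with largest critical submodule `O`, i.e. the pair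
`(E, O)` represents a point `x` of the injective spectrum, together with its module `Õ_x`. -/
structure IsSpectralPair (E : C) (O : Subobject E) : Prop where
  injective : Injective E
  indecomposable : Indecomposable E
  largestCritical : d.IsLargestCritical O

/-- `W` is a weak point: `W = σ[Õ_x]` for some `x` in the injective spectrum. -/
def IsWeakPoint (W : ObjectProperty C) : Prop :=
  ∃ (E : C) (O : Subobject E), d.IsSpectralPair E O ∧ W = sigma (O : C)

/-- `W` is a point: `W = σ[Õ_x]` for some `x` in the injective spectrum with `Õ_x` tiny. -/
def IsPoint (W : ObjectProperty C) : Prop :=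
  ∃ (E : C) (O : Subobject E), d.IsSpectralPair E O ∧ d.IsTiny (O : C) ∧ W = sigma (O : C)

/-- The extension `W|^X` of a weak point `W = σ[Õ_x]` of a weakly closed subspace `Z`:
it is `σ[O']`, where `O'` is the largest critical submodule of an injective hull `E'`
of `i_* Õ_x` in the ambient space. -/
def extension (Z : ObjectProperty C) [IsWeaklyClosed Z]
    (W : ObjectProperty Z.FullSubcategory) : ObjectProperty C := fun N =>
  ∃ (E : Z.FullSubcategory) (O : Subobject E) (E' : C)
    (j : (O : Z.FullSubcategory).obj ⟶ E') (O' : Subobject E'),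
    (d.restrict Z).IsSpectralPair E O ∧ W = sigma (O : Z.FullSubcategory) ∧
      IsInjectiveHull j ∧ d.IsLargestCritical O' ∧ sigma (O' : C) N

end DimensionFunction

/-- `M` is supported at `Z`, i.e. `M` belongs to the saturation `Mod_Z X`: there is an
exhaustive filtration `0 = F₀ ≤ F₁ ≤ ⋯` of `M` with successive quotients in `Z`. -/
def IsSupportedAt (Z : ObjectProperty C) (M : C) : Prop :=
  ∃ F : ℕ →o Subobject M, F 0 = ⊥ ∧ IsLUB (Set.range F) ⊤ ∧
    ∀ n, Z (cokernel (Subobject.ofLE (F n) (F (n + 1)) (F.monotone n.le_succ)))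

/-- A nonzero object `M` is prime if `π[M] = π[N]` for every nonzero `N ≤ M`. -/
def IsPrimeModule (M : C) : Prop :=
  ¬ IsZero M ∧ ∀ N : Subobject M, N ≠ ⊥ → pi M = pi (N : C)

/-- Every nonzero object contains a prime subobject. -/
def HasEnoughPrimes (C : Type u) [Category.{v} C] [Abelian C] : Prop :=
  ∀ M : C, ¬ IsZero M → ∃ N : Subobject M, IsPrimeModule (N : C)

/-- `X_red`: the smallest closed subspace containing all prime modules. -/
def reduced (C : Type u) [Category.{v} C] [Abelian C] : ObjectProperty C :=
  closedSpan IsPrimeModule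

instance : IsClosedSubspace (reduced C) := closedSpan_isClosedSubspace _

end Abelian

end NCSpace

open NCSpace

namespace NCSpace

/-! ### Subobject calculus by generalized elements, and modularity -/

section Lattice

variable {C : Type u} [Category.{v} C] [Abelian C]

/-! Tininess of an `α`-critical module `M` depends only on the simple object `π_α M`. For a nonzero
`N ≤ M` the quotient `M/N` has dimension less than `α`, so `π_α N ≅ π_α M`. Critical modules sharing
a nonzero submodule are therefore tiny together (`IsCriticalOfDim.isTiny_of_common`). In particular
`Õ` may be replaced by the largest critical submodule of its hull in `Mod X`, and part (1) reduces
to two points.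

Tininess of `Õ` in `Z` and in `X` agree. The functor `F` induced between the quotient categories by
the inclusion of `Z` is fully faithful and its image is closed under subobjects, so it preserves and
reflects noetherian objects (`exists_localization_functor`). Tininess in `X` thus restricts to `Z`.
Conversely, lift a noetherian object of the quotient of `X` to a module `N` and filter `N` with
factors in `Z`. Noetherianity, together with the closure of `C_{<α}` under direct sums, shows that
`π_α N` is already the image of a finite stage (`exists_isoModSerre_filtration`). By Schur's lemma
`End (π_α Õ)` is a division ring, so finite generation of Hom passes along the finitely many
extensions (`isTinyObject_of_restrict`).

Both notions depend only on the subspace, not on the injective representing it. Two critical modules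
with the same `σ` share a nonzero submodule (`exists_common_of_sigma`): containing a piece of `B` in
every `α`-critical subquotient is a weakly closed condition, satisfied by `B` itself. Hence the
extension is well defined (`extension_eq_sigma`).

For part (2), enough primes give every nonzero module a nonzero submodule in `X_red`. Repeatedly
adjoining the largest submodule of the quotient lying in `X_red` produces a filtration, and testing
it on noetherian generators shows that it is exhaustive after `ω` steps
(`isSupportedAt_of_forall_exists`). -/

lemma factors_of_epi_comp {X Y T : C} {P : Subobject X} (e : T ⟶ Y) [Epi e] (h : Y ⟶ X)
    (H : P.Factors (e ≫ h)) : P.Factors h := by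
  have sq : CommSq (P.factorThru _ H) e P.arrow h := ⟨by simp⟩
  have := strongEpi_of_epi e
  rw [← sq.fac_right]
  exact Subobject.factors_comp_arrow _

lemma factors_iff_comp_cokernel_eq_zero {X Y : C} (P : Subobject X) (h : Y ⟶ X) :
    P.Factors h ↔ h ≫ cokernel.π P.arrow = 0 := by
  constructor
  · intro H
    rw [← P.factorThru_arrow h H, Category.assoc, cokernel.condition, comp_zero]
  · intro H
    rw [← Abelian.monoLift_comp P.arrow h H]
    exact Subobject.factors_comp_arrow _

/-- The join is the image of `A ⊞ B`; after pulling back along that epimorphism, a generalized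
element of `A ⊔ B` becomes a sum of elements of `A` and `B`. -/
lemma exists_refinement_of_factors_sup {X Y : C} {A B : Subobject X} (h : Y ⟶ X)
    (H : (A ⊔ B).Factors h) : ∃ (T : C) (e : T ⟶ Y) (_ : Epi e) (a b : T ⟶ X),
      A.Factors a ∧ B.Factors b ∧ e ≫ h = a + b := by
  let q : (A : C) ⊞ (B : C) ⟶ X := biprod.desc A.arrow B.arrow
  have hle : A ⊔ B ≤ imageSubobject q := by
    refine sup_le ?_ ?_
    · refine Subobject.le_of_comm (biprod.inl ≫ factorThruImageSubobject q) (by simp [q])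
    · refine Subobject.le_of_comm (biprod.inr ≫ factorThruImageSubobject q) (by simp [q])
  have H' := Subobject.factors_of_le h hle H
  let k := Subobject.factorThru _ h H'
  refine ⟨pullback (factorThruImageSubobject q) k, pullback.snd _ _, inferInstance,
    pullback.fst _ _ ≫ biprod.fst ≫ A.arrow, pullback.fst _ _ ≫ biprod.snd ≫ B.arrow,
    ?_, ?_, ?_⟩
  · exact Subobject.factors_of_factors_right _ (Subobject.factors_comp_arrow _)
  · exact Subobject.factors_of_factors_right _ (Subobject.factors_comp_arrow _)
  · have h1 : pullback.snd (factorThruImageSubobject q) k ≫ h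
        = pullback.fst _ _ ≫ q := by
      rw [← Subobject.factorThru_arrow _ h H', ← pullback.condition_assoc]
      simp
    rw [h1, ← Preadditive.comp_add]
    congr 1
    ext <;> simp [q]

lemma factors_sub {X Y : C} {P : Subobject X} {f g : Y ⟶ X} (hf : P.Factors f)
    (hg : P.Factors g) : P.Factors (f - g) := by
  rw [factors_iff_comp_cokernel_eq_zero] at *
  simp [Preadditive.sub_comp, hf, hg]

instance isModularLattice_subobject (X : C) : IsModularLattice (Subobject X) where
  sup_inf_le_assoc_of_le {x} y {z} hxz := by
    refine Subobject.le_of_factors ?_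
    have h1 := Subobject.factors_left_of_inf_factors
      (Subobject.factors_self ((x ⊔ y) ⊓ z))
    have h2 := Subobject.factors_right_of_inf_factors
      (Subobject.factors_self ((x ⊔ y) ⊓ z))
    obtain ⟨T, e, _, a, b, ha, hb, hab⟩ := exists_refinement_of_factors_sup _ h1
    refine factors_of_epi_comp e _ ?_
    have hb' : z.Factors b := by
      have : b = e ≫ ((x ⊔ y) ⊓ z).arrow - a := by rw [hab]; abel
      rw [this]
      exact factors_sub (Subobject.factors_of_factors_right _ h2)
        (Subobject.factors_of_le _ hxz ha)
    rw [hab]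
    exact Subobject.factors_add _ _ (Subobject.sup_factors_of_factors_left ha)
      (Subobject.sup_factors_of_factors_right ((Subobject.inf_factors _).2 ⟨hb, hb'⟩))

lemma subobject_eq_bot_iff_isZero {X : C} (N : Subobject X) : N = ⊥ ↔ IsZero (N : C) := by
  constructor
  · rintro rfl
    exact (isZero_zero C).of_iso Subobject.botCoeIsoZero
  · intro h
    rw [← Subobject.mk_arrow N, Subobject.mk_eq_bot_iff_zero]
    exact h.eq_of_src _ _

lemma mk_ne_bot {X Y : C} (f : X ⟶ Y) [Mono f] (h : ¬ IsZero X) : Subobject.mk f ≠ ⊥ := by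
  rw [Ne, subobject_eq_bot_iff_isZero]
  exact fun h' => h (h'.of_iso (Subobject.underlyingIso f).symm)

lemma isZero_of_factors_inf_eq_bot {X Y : C} {A B : Subobject X} (h : A ⊓ B = ⊥) (f : Y ⟶ X)
    (hA : A.Factors f) (hB : B.Factors f) : f = 0 := by
  have := (Subobject.inf_factors f).2 ⟨hA, hB⟩
  rwa [h, Subobject.bot_factors_iff_zero] at this

lemma pullback_factors_iff {X Y T : C} (f : X ⟶ Y) (P : Subobject Y) (g : T ⟶ X) :
    ((Subobject.pullback f).obj P).Factors g ↔ P.Factors (g ≫ f) := by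
  constructor
  · intro h
    rw [← Subobject.factorThru_arrow _ g h, Category.assoc, (Subobject.isPullback f P).w.symm]
    exact Subobject.factors_of_factors_right _ (Subobject.factors_comp_arrow _)
  · intro h
    rw [← (Subobject.isPullback f P).lift_snd (P.factorThru _ h) g (by simp)]
    exact Subobject.factors_comp_arrow _

lemma mk_le_pullback {X Y T : C} (f : X ⟶ Y) (P : Subobject Y) (m : T ⟶ X) [Mono m]
    (h : P.Factors (m ≫ f)) : Subobject.mk m ≤ (Subobject.pullback f).obj P := by
  refine Subobject.le_of_factors ?_
  rw [← Subobject.underlyingIso_hom_comp_eq_mk]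
  exact Subobject.factors_of_factors_right _ ((pullback_factors_iff _ _ _).2 h)

end Lattice

/-! ### AB5, pseudo-complements and injective hulls -/

section Grothendieck

variable {C : Type u} [Category.{v} C] [Abelian C] [IsGrothendieckAbelian.{v} C]

section

attribute [local instance] IsFiltered.isConnected

open IsGrothendieckAbelian in
open IsGrothendieckAbelian.IsPresentable in
/-- Grothendieck's axiom AB5 for subobjects. -/
lemma iSup_pullback_eq_top {X K : C} {J : Type v} [Preorder J] [IsDirectedOrder J] [Nonempty J]
    (S : J →o Subobject X) (f : K ⟶ X) (hf : (⨆ j, S j).Factors f) :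
    ⨆ j, (Subobject.pullback f).obj (S j) = ⊤ := by
  let G : J ⥤ MonoOver X := S.monotone.functor ⋙ Subobject.representative
  have hG (j : J) : Subobject.mk (G.obj j).obj.hom = S j := Subobject.mk_arrow (S j)
  let c : Cocone (G ⋙ MonoOver.forget _) :=
    { pt := Over.mk (⨆ j, S j).arrow
      ι := { app := fun j => Over.homMk (Subobject.ofLE (S j) _ (le_iSup S j))
                (Subobject.ofLE_arrow _)
             naturality := fun j j' g => by
               ext
               rw [← cancel_mono (⨆ j, S j).arrow]
               refine Eq.trans (Category.assoc _ _ _) ?_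
               refine Eq.trans (congrArg _ (Subobject.ofLE_arrow _)) ?_
               refine Eq.trans (MonoOver.w (G.map g)) ?_
               refine (Subobject.ofLE_arrow (le_iSup S j)).symm.trans ?_
               exact congrArg (· ≫ (⨆ j, S j).arrow) (Category.comp_id _).symm } }
  have : Mono c.pt.hom := inferInstanceAs (Mono (⨆ j, S j).arrow)
  have hc := isColimitMapCoconeOfSubobjectMkEqISup G c (by
    simp only [hG]
    exact Subobject.mk_arrow _)
  have hmono (j : J) : Mono (((Over.forget X).mapCocone c).ι.app j) :=
    inferInstanceAs (Mono (Subobject.ofLE (S j) _ (le_iSup S j)))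
  have := NatTrans.mono_of_mono_app ((Over.forget X).mapCocone c).ι
  let z : K ⟶ ((Over.forget X).mapCocone c).pt := Subobject.factorThru _ f hf
  -- Exactness of filtered colimits enters here: `K` is the colimit of the pullbacks of the `S j`
  -- along `z`.
  have hiso := surjectivity.isIso_f hc z
  have key := subobjectMk_of_isColimit_eq_iSup (surjectivity.F z) (colimit.isColimit _)
    (surjectivity.f z) (surjectivity.hf z)
  replace key := (Subobject.mk_eq_top_of_isIso (surjectivity.f z)).symm.trans key
  rw [eq_top_iff, key]
  refine iSup_mono fun j => ?_
  refine mk_le_pullback f (S j) _ ?_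
  let a := (pullback.fst ((Over.forget X).mapCocone c).ι ((Functor.const _).map z)).app j
  let b := (pullback.snd ((Over.forget X).mapCocone c).ι ((Functor.const _).map z)).app j
  have hz : z ≫ (⨆ j, S j).arrow = f := Subobject.factorThru_arrow _ f hf
  have hab : a ≫ Subobject.ofLE (S j) _ (le_iSup S j) = b ≫ z := NatTrans.congr_app
      (pullback.condition (f := ((Over.forget X).mapCocone c).ι) (g := (Functor.const _).map z)) j
  have h2 : b ≫ f = a ≫ (S j).arrow := by
    refine (congrArg (b ≫ ·) hz.symm).trans ?_
    refine (Category.assoc _ _ _).symm.trans ?_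
    refine (congrArg (· ≫ (⨆ j, S j).arrow) hab.symm).trans ?_
    refine (Category.assoc _ _ _).trans ?_
    exact congrArg (a ≫ ·) (Subobject.ofLE_arrow (le_iSup S j))
  have h3 : (S j).Factors (b ≫ f) := by
    rw [h2]
    exact Subobject.factors_comp_arrow (P := S j) a
  exact h3

end

end Grothendieck
section Grothendieck

variable {C : Type u} [Category.{v} C] [Abelian C] [IsGrothendieckAbelian.{v} C]

/-- AB5 in the form used below: a morphism vanishes once it vanishes on the preimages of the members
of a directed family whose supremum contains the image of `f`. -/
lemma eq_zero_of_directed_sSup {X K Q : C} (s : Set (Subobject X)) (hs : s.Nonempty)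
    (hd : DirectedOn (· ≤ ·) s) (f : K ⟶ X) (hf : (sSup s).Factors f) (p : K ⟶ Q)
    (hp : ∀ A ∈ s, ((Subobject.pullback f).obj A).arrow ≫ p = 0) : p = 0 := by
  let J := Shrink.{v} s
  let e : J ≃ s := (equivShrink s).symm
  let _ : Preorder J := Preorder.lift e
  have : IsDirectedOrder J := ⟨fun a b => by
    obtain ⟨z, hz, h1, h2⟩ := hd _ (e a).2 _ (e b).2
    exact ⟨e.symm ⟨z, hz⟩, show (e a).1 ≤ (e (e.symm _)).1 by simpa using h1,
      show (e b).1 ≤ (e (e.symm _)).1 by simpa using h2⟩⟩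
  have : Nonempty J := ⟨e.symm ⟨_, hs.some_mem⟩⟩
  let S : J →o Subobject X := ⟨fun j => (e j).1, fun a b h => h⟩
  have hS : ⨆ j, S j = sSup s := by
    rw [sSup_eq_iSup', ← e.iSup_comp]
    rfl
  have h1 := iSup_pullback_eq_top S f (by rwa [hS])
  have h2 : ⨆ j, (Subobject.pullback f).obj (S j) ≤ kernelSubobject p :=
    iSup_le fun j => le_kernelSubobject _ _ (hp _ (e j).2)
  rw [h1, top_le_iff] at h2
  have h3 : (kernelSubobject p).Factors (𝟙 K) := h2 ▸ Subobject.top_factors _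
  simpa using (kernelSubobject_factors_iff p (𝟙 K)).1 h3

lemma inf_directed_sSup_eq_bot {X : C} (A : Subobject X) (s : Set (Subobject X))
    (hs : s.Nonempty) (hd : DirectedOn (· ≤ ·) s) (h : ∀ B ∈ s, A ⊓ B = ⊥) :
    A ⊓ sSup s = ⊥ := by
  have h0 : (𝟙 ((A ⊓ sSup s : Subobject X) : C)) = 0 := by
    refine eq_zero_of_directed_sSup s hs hd (A ⊓ sSup s).arrow
      (Subobject.factors_right_of_inf_factors (Subobject.factors_self _)) _ fun B hB => ?_
    rw [Category.comp_id, ← cancel_mono (A ⊓ sSup s).arrow, zero_comp]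
    refine isZero_of_factors_inf_eq_bot (h B hB) _ ?_ ?_
    · exact Subobject.factors_of_factors_right _
        (Subobject.factors_left_of_inf_factors (Subobject.factors_self _))
    · exact (pullback_factors_iff _ _ _).1 (Subobject.factors_self _)
  rw [subobject_eq_bot_iff_isZero, IsZero.iff_id_eq_zero]
  exact h0

/-- Pseudo-complements exist among the subobjects containing a given one. -/
lemma exists_maximal_disjoint {X : C} (A B : Subobject X) (hAB : A ⊓ B = ⊥) :
    ∃ D, B ≤ D ∧ A ⊓ D = ⊥ ∧ ∀ D', D ≤ D' → A ⊓ D' = ⊥ → D' = D := by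
  obtain ⟨D, hBD, hD⟩ := zorn_le_nonempty₀ {D : Subobject X | A ⊓ D = ⊥} (by
    intro c hc hchain y hy
    exact ⟨sSup c, inf_directed_sSup_eq_bot A c ⟨y, hy⟩ hchain.directedOn (fun B hB => hc hB),
      fun z hz => le_sSup hz⟩) B hAB
  exact ⟨D, hBD, hD.prop, fun D' h h' => (hD.eq_of_le h' h).symm⟩

/-- Injective hulls exist in Grothendieck categories. -/
lemma exists_injectiveHull (M : C) : ∃ (E : C) (j : M ⟶ E), IsInjectiveHull j := by
  let I : C := Injective.under M
  let m : Subobject I := Subobject.mk (Injective.ι M)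
  -- `D` is a pseudo-complement of `M` in an injective `I`, and `E ≥ M` one of `D`. The hull is `E`:
  -- it is essential over `M` by modularity, and it is a retract of `I`.
  obtain ⟨D, -, hD, hDmax⟩ := exists_maximal_disjoint m ⊥ (inf_bot_eq _)
  obtain ⟨E, hmE, hE, hEmax⟩ := exists_maximal_disjoint D m (by rwa [inf_comm])
  have hess (N : Subobject I) (hN : N ≤ E) (h : N ⊓ m = ⊥) : N = ⊥ := by
    have h1 : (N ⊔ D) ⊓ E = N := by
      rw [sup_inf_assoc_of_le _ hN, hE, sup_bot_eq]
    have h2 : m ⊓ (D ⊔ N) = ⊥ := by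
      rw [eq_bot_iff, ← h]
      refine le_inf ?_ inf_le_left
      exact (le_inf (inf_le_right.trans (sup_comm D N).le) (inf_le_left.trans hmE)).trans h1.le
    have h3 : N ≤ D := by rw [← hDmax _ le_sup_left h2]; exact le_sup_right
    rw [eq_bot_iff, ← hE]
    exact le_inf h3 hN
  have hmono : Mono (E.arrow ≫ cokernel.π D.arrow) := by
    rw [Preadditive.mono_iff_cancel_zero]
    intro P g hg
    rw [← cancel_mono E.arrow, zero_comp]
    rw [← Category.assoc, ← factors_iff_comp_cokernel_eq_zero] at hg
    exact isZero_of_factors_inf_eq_bot hE _ hg (Subobject.factors_comp_arrow _)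
  -- `E` embeds in `I/D`, so its inclusion extends to `I/D`. The resulting endomorphism `h` of `I`
  -- is the identity on `E` and kills `D`; maximality of `D` and then of `E` forces its image to be
  -- exactly `E`.
  let g : cokernel D.arrow ⟶ I := Injective.factorThru E.arrow (E.arrow ≫ cokernel.π D.arrow)
  have hg : E.arrow ≫ cokernel.π D.arrow ≫ g = E.arrow := by
    rw [← Category.assoc]
    exact Injective.comp_factorThru E.arrow (E.arrow ≫ cokernel.π D.arrow)
  let h : I ⟶ I := cokernel.π D.arrow ≫ g
  let D' := (Subobject.pullback h).obj D
  have hD' : D' = D := by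
    have hle : D ≤ D' := by
      refine Subobject.le_of_factors ?_
      rw [pullback_factors_iff]
      simp only [h, cokernel.condition_assoc, zero_comp]
      exact Subobject.factors_zero
    refine hDmax _ hle ?_
    rw [eq_bot_iff, ← hE]
    refine Subobject.le_of_factors ?_
    have h1 : E.Factors (m ⊓ D').arrow := Subobject.factors_of_le _ hmE
      (Subobject.factors_left_of_inf_factors (Subobject.factors_self _))
    have h2 : D'.Factors (m ⊓ D').arrow :=
      Subobject.factors_right_of_inf_factors (Subobject.factors_self _)
    rw [pullback_factors_iff, ← E.factorThru_arrow _ h1, Category.assoc, hg,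
      E.factorThru_arrow _ h1] at h2
    exact (Subobject.inf_factors _).2 ⟨h2, h1⟩
  have him : imageSubobject h = E := by
    refine hEmax _ ?_ ?_
    · refine Subobject.le_of_factors ?_
      rw [← hg]
      exact Subobject.factors_of_factors_right _
        ((Subobject.factors_iff _ _).2 ⟨factorThruImageSubobject h, imageSubobject_arrow_comp h⟩)
    · have h1 := Subobject.factors_right_of_inf_factors
        (Subobject.factors_self (D ⊓ imageSubobject h))
      let t := Subobject.factorThru _ _ h1
      have h2 : pullback.fst (factorThruImageSubobject h) t ≫ h
          = pullback.snd _ _ ≫ (D ⊓ imageSubobject h).arrow := by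
        rw [← Subobject.factorThru_arrow _ _ h1, ← pullback.condition_assoc,
          imageSubobject_arrow_comp]
      have h3 : D.Factors (pullback.fst (factorThruImageSubobject h) t) := by
        refine Subobject.factors_of_le _ hD'.le ?_
        rw [pullback_factors_iff, h2]
        exact Subobject.factors_of_factors_right _
          (Subobject.factors_left_of_inf_factors (Subobject.factors_self _))
      have h4 : pullback.fst (factorThruImageSubobject h) t ≫ h = 0 := by
        rw [← Subobject.factorThru_arrow _ _ h3, Category.assoc, cokernel.condition_assoc, zero_comp,
          comp_zero]
      rw [h2] at h4
      have h5 : (D ⊓ imageSubobject h).arrow = 0 := by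
        rw [← cancel_epi (pullback.snd (factorThruImageSubobject h) t), h4, comp_zero]
      rw [← Subobject.mk_arrow (D ⊓ imageSubobject h), Subobject.mk_eq_bot_iff_zero, h5]
  have hfac : E.Factors h := by
    rw [← him]
    exact (Subobject.factors_iff _ _).2 ⟨factorThruImageSubobject h, imageSubobject_arrow_comp h⟩
  have hret : Retract (E : C) I :=
    { i := E.arrow
      r := E.factorThru h hfac
      retract := by
        rw [← cancel_mono E.arrow, Category.assoc, E.factorThru_arrow, hg, Category.id_comp] }
  have hM := Subobject.factors_of_le _ hmE (Subobject.mk_factors_self (Injective.ι M))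
  have hj : Mono (E.factorThru _ hM) := mono_of_mono_fac (Subobject.factorThru_arrow _ _ _)
  refine ⟨E, E.factorThru _ hM, hj, ?_, ?_⟩
  · exact hret.injective
  · intro N hN h0
    have h1 : m = (Subobject.map E.arrow).obj (Subobject.mk (E.factorThru _ hM)) := by
      rw [Subobject.map_mk]
      simp [m]
    have h2 : (Subobject.map E.arrow).obj N = ⊥ := by
      refine hess _ ?_ ?_
      · conv_rhs => rw [← Subobject.mk_arrow E, ← Subobject.map_top]
        exact (Subobject.map E.arrow).monotone le_top
      · rw [h1, ← Subobject.inf_map, h0, Subobject.map_bot]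
    refine hN (Subobject.map_obj_injective E.arrow ?_)
    rw [h2, Subobject.map_bot]

end Grothendieck
-- Critical objects
lemma mono_cokernel_map_comp {C : Type*} [Category* C] [Abelian C] {K N M : C} (g : K ⟶ N)
    (f : N ⟶ M) [Mono g] [Mono f] : Mono (cokernel.map g (g ≫ f) (𝟙 _) f (by simp)) := by
  rw [Preadditive.mono_iff_cancel_zero]
  intro P x hx
  have hs : pullback.snd (cokernel.π g) x ≫ x = pullback.fst _ _ ≫ cokernel.π g :=
    pullback.condition.symm
  rw [← cancel_epi (pullback.snd (cokernel.π g) x), hs, comp_zero]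
  have h1 : (pullback.fst (cokernel.π g) x ≫ f) ≫ cokernel.π (g ≫ f) = 0 := by
    have := congrArg (pullback.snd (cokernel.π g) x ≫ ·) hx
    simp only [comp_zero] at this
    rw [← Category.assoc, hs] at this
    simpa using this
  have h2 : pullback.fst (cokernel.π g) x = Abelian.monoLift (g ≫ f) _ h1 ≫ g := by
    rw [← cancel_mono f, Category.assoc, Abelian.monoLift_comp]
  rw [h2, Category.assoc, cokernel.condition, comp_zero]

/-- If `O ⟶ O' ⟶ E` are monomorphisms and `O' ⟶ E / O` factors through `A ≤ E / O`, then
`O' / O` embeds in `A`. -/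
lemma exists_mono_cokernel {C : Type*} [Category* C] [Abelian C] {O O' E : C} (k : O ⟶ O')
    (m : O' ⟶ E) [Mono k] [Mono m] {j : O ⟶ E} (hj : k ≫ m = j) (A : Subobject (cokernel j))
    (hA : A.Factors (m ≫ cokernel.π j)) :
    ∃ f : cokernel k ⟶ (A : C), Mono f := by
  subst hj
  have := mono_cokernel_map_comp k m
  have hk : k ≫ A.factorThru _ hA = 0 := by
    rw [← cancel_mono A.arrow, Category.assoc, A.factorThru_arrow, ← Category.assoc,
      cokernel.condition, zero_comp]
  have hfac : cokernel.desc k (A.factorThru _ hA) hk ≫ A.arrow =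
      cokernel.map k (k ≫ m) (𝟙 _) m (by simp) := by
    ext
    simp
  exact ⟨cokernel.desc k (A.factorThru _ hA) hk, mono_of_mono_fac hfac⟩

namespace DimensionFunction

section Critical

variable {C : Type u} [Category.{v} C] [Abelian C] {d : DimensionFunction.{t} C}

lemma dim_eq_max_of_mono (d : DimensionFunction.{t} C) {N M : C} (f : N ⟶ M) [Mono f] :
    d.dim M = max (d.dim N) (d.dim (cokernel f)) :=
  d.exact (ShortComplex.mk f (cokernel.π f) (by simp))
    (ShortComplex.ShortExact.mk (ShortComplex.exact_cokernel f))

/-- The dimension of the target is the maximum of those of the image and the cokernel. -/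
lemma dim_lt_of_image_of_cokernel {N M : C} (f : N ⟶ M) {α : WithBot Ordinal.{t}}
    (h₁ : d.dim (Abelian.image f) < α) (h₂ : d.dim (cokernel f) < α) : d.dim M < α := by
  rw [d.dim_eq_max_of_mono (Abelian.image.ι f)]
  refine max_lt h₁ ?_
  have := d.dim_le_of_epi (cokernel.desc f (cokernel.π (Abelian.image.ι f)) (by
    calc f ≫ cokernel.π (Abelian.image.ι f)
        = (Abelian.factorThruImage f ≫ Abelian.image.ι f) ≫ cokernel.π (Abelian.image.ι f) := by
          rw [Abelian.image.fac]
      _ = 0 := by rw [Category.assoc, cokernel.condition, comp_zero]))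
  exact this.trans_lt h₂

variable {α : Ordinal.{t}} {M : C}

lemma IsCriticalOfDim.not_isZero (h : d.IsCriticalOfDim α M) : ¬ IsZero M := by
  rw [← d.dim_eq_bot_iff, h.1]
  exact WithBot.coe_ne_bot

lemma IsCriticalOfDim.dim_cokernel_lt (h : d.IsCriticalOfDim α M) {N : C} (f : N ⟶ M) [Mono f]
    (hN : ¬ IsZero N) : d.dim (cokernel f) < α := by
  have := h.2 (Subobject.mk f) (mk_ne_bot f hN)
  refine lt_of_eq_of_lt (d.dim_congr ?_) this
  exact (cokernelEpiComp (Subobject.underlyingIso f).hom f).symm ≪≫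
    cokernelIsoOfEq (Subobject.underlyingIso_hom_comp_eq_mk f)

lemma IsCriticalOfDim.dim_eq_of_mono (h : d.IsCriticalOfDim α M) {N : C} (f : N ⟶ M) [Mono f]
    (hN : ¬ IsZero N) : d.dim N = α := by
  have h1 := d.dim_eq_max_of_mono f
  have h2 := h.dim_cokernel_lt f hN
  rw [h.1] at h1
  rcases max_choice (d.dim N) (d.dim (cokernel f)) with h3 | h3
  · rw [h1, h3]
  · rw [← h3, ← h1] at h2
    exact absurd h2 (lt_irrefl _)

lemma isCriticalOfDim_of_forall_mono (h : d.dim M = α)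
    (h' : ∀ (N : C) (f : N ⟶ M) [Mono f], ¬ IsZero N → d.dim (cokernel f) < α) :
    d.IsCriticalOfDim α M :=
  ⟨h, fun N hN => h' _ N.arrow (by rwa [Ne, subobject_eq_bot_iff_isZero] at hN)⟩

lemma IsCriticalOfDim.of_mono (h : d.IsCriticalOfDim α M) {N : C} (f : N ⟶ M) [Mono f]
    (hN : ¬ IsZero N) : d.IsCriticalOfDim α N := by
  refine isCriticalOfDim_of_forall_mono (h.dim_eq_of_mono f hN) fun K g _ hK => ?_
  have := mono_cokernel_map_comp g f
  exact (d.dim_le_of_mono (cokernel.map g (g ≫ f) (𝟙 _) f _)).trans_lt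
    (h.dim_cokernel_lt (g ≫ f) hK)

lemma IsCriticalOfDim.of_iso (h : d.IsCriticalOfDim α M) {N : C} (e : N ≅ M) :
    d.IsCriticalOfDim α N :=
  h.of_mono e.hom fun hN => h.not_isZero (hN.of_iso e.symm)

lemma IsCriticalOfDim.dim_lt_of_epi (h : d.IsCriticalOfDim α M) {Q : C} (p : M ⟶ Q) [Epi p]
    (hp : ¬ Mono p) : d.dim Q < α := by
  have h1 := h.dim_cokernel_lt (kernel.ι p) (fun h0 => hp
    (Preadditive.mono_of_kernel_zero (h0.eq_of_src _ _)))
  exact (d.dim_congr (asIso (Abelian.factorThruCoimage p))).symm.trans_lt h1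

/-- Critical objects are uniform. -/
lemma IsCriticalOfDim.not_isZero_pullback (h : d.IsCriticalOfDim α M) {A B : C} (f : A ⟶ M)
    (g : B ⟶ M) [Mono f] [Mono g] (hA : ¬ IsZero A) (hB : ¬ IsZero B) :
    ¬ IsZero (pullback f g) := by
  intro h0
  -- If `A` and `B` were disjoint, `A`, of dimension `α`, would embed in `M/B`, of dimension less
  -- than `α`.
  have : Mono (f ≫ cokernel.π g) := by
    rw [Preadditive.mono_iff_cancel_zero]
    intro P x hx
    rw [← Category.assoc] at hx
    have h1 := pullback.lift_fst (f := f) (g := g) x (Abelian.monoLift g _ hx)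
      (Abelian.monoLift_comp _ _ _).symm
    rw [← h1, h0.eq_of_src (pullback.fst f g) 0, comp_zero]
  have h1 := (d.dim_le_of_mono (f ≫ cokernel.π g)).trans_lt (h.dim_cokernel_lt g hB)
  rw [h.dim_eq_of_mono f hA] at h1
  exact lt_irrefl _ h1

lemma IsCriticalOfDim.eq_of_common {β : Ordinal.{t}} {M' : C} (h : d.IsCriticalOfDim α M)
    (h' : d.IsCriticalOfDim β M') {N : C} (f : N ⟶ M) (g : N ⟶ M') [Mono f] [Mono g]
    (hN : ¬ IsZero N) : α = β := by
  have := (h.dim_eq_of_mono f hN).symm.trans (h'.dim_eq_of_mono g hN)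
  exact_mod_cast this

/-- An object which is an extension of an object of dimension less than `α` by an essential
`α`-critical subobject is `α`-critical. -/
lemma IsCriticalOfDim.of_essential (h : d.IsCriticalOfDim α M) {M' : C} (f : M ⟶ M') [Mono f]
    (hf : d.dim (cokernel f) < α)
    (hess : ∀ (N : C) (g : N ⟶ M') [Mono g], ¬ IsZero N → ¬ IsZero (pullback g f)) :
    d.IsCriticalOfDim α M' := by
  refine isCriticalOfDim_of_forall_mono ?_ fun N g _ hN => ?_
  · rw [d.dim_eq_max_of_mono f, h.1, max_eq_left hf.le]
  -- The image of `M` in `M'/N` is a quotient of `M/(N ∩ M)`, where `N ∩ M` is nonzero by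
  -- essentiality; the cokernel is a quotient of `M'/M`.
  · refine dim_lt_of_image_of_cokernel (f ≫ cokernel.π g) ?_ ?_
    · have h1 := h.dim_cokernel_lt (pullback.snd g f) (hess N g hN)
      have := d.dim_le_of_epi (cokernel.desc (pullback.snd g f)
        (Abelian.factorThruImage (f ≫ cokernel.π g)) (by
          rw [← cancel_mono (Abelian.image.ι _), Category.assoc, Abelian.image.fac,
            ← pullback.condition_assoc, cokernel.condition, comp_zero, zero_comp]))
      exact this.trans_lt h1
    · have := d.dim_le_of_epi (cokernel.desc f
        (cokernel.π g ≫ cokernel.π (f ≫ cokernel.π g)) (by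
          rw [← Category.assoc, cokernel.condition]))
      exact this.trans_lt hf

end Critical

end DimensionFunction

/-! ### Injective hulls of critical objects and their largest critical subobjects -/

section Largest

variable {C : Type u} [Category.{v} C] [Abelian C] [IsGrothendieckAbelian.{v} C]

/-- For a class of objects closed under quotients and direct sums, every object has a largest
subobject in this class. -/
lemma exists_largest_subobject (P : ObjectProperty C) [P.IsClosedUnderQuotients]
    (hP : ∀ ι : Type v, P.IsClosedUnderColimitsOfShape (Discrete ι)) (Y : C) :
    ∃ A : Subobject Y, P (A : C) ∧ ∀ (N : C) (f : N ⟶ Y), P N → A.Factors f := by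
  let J := Shrink.{v} {N : Subobject Y // P (N : C)}
  let S (j : J) : Subobject Y := ((equivShrink _).symm j).1
  let q : (∐ fun j => (S j : C)) ⟶ Y := Sigma.desc fun j => (S j).arrow
  refine ⟨imageSubobject q, ?_, fun N f hN => ?_⟩
  · have := hP J
    have h1 : P (∐ fun j => (S j : C)) :=
      P.prop_colimit _ (fun j => ((equivShrink _).symm j.as).2)
    exact P.prop_of_epi (factorThruImageSubobject q) h1
  · have h1 : P (imageSubobject f : C) := P.prop_of_epi (factorThruImageSubobject f) hN
    let j : J := equivShrink _ ⟨_, h1⟩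
    have hj : S j = imageSubobject f := by simp [S, j]
    have h2 : imageSubobject f ≤ imageSubobject q := by
      rw [← hj]
      exact Subobject.le_of_comm (Sigma.ι (fun j => (S j : C)) j ≫ factorThruImageSubobject q)
        (by simp [q])
    exact Subobject.factors_of_le _ h2
      ((Subobject.factors_iff _ _).2 ⟨factorThruImageSubobject f, imageSubobject_arrow_comp f⟩)

end Largest

section Hull

variable {C : Type u} [Category.{v} C] [Abelian C]

lemma IsInjectiveHull.not_isZero_pullback {M E : C} {j : M ⟶ E} (hj : IsInjectiveHull j)
    {N : C} (g : N ⟶ E) [Mono g] (hN : ¬ IsZero N) : ¬ IsZero (pullback g j) := by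
  have := hj.mono
  intro h0
  refine hj.essential (Subobject.mk g) (mk_ne_bot g hN) ?_
  obtain ⟨a, ha⟩ := (Subobject.mk_factors_iff g _).1
    (Subobject.factors_left_of_inf_factors
      (Subobject.factors_self (Subobject.mk g ⊓ Subobject.mk j)))
  obtain ⟨b, hb⟩ := (Subobject.mk_factors_iff j _).1
    (Subobject.factors_right_of_inf_factors
      (Subobject.factors_self (Subobject.mk g ⊓ Subobject.mk j)))
  have h1 : (Subobject.mk g ⊓ Subobject.mk j).arrow = 0 := by
    have h2 := pullback.lift_fst (f := g) (g := j) a b (ha.trans hb.symm)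
    rw [h0.eq_of_src (pullback.fst g j) 0, comp_zero] at h2
    rw [← ha, ← h2]
    exact zero_comp
  rw [← Subobject.mk_arrow (Subobject.mk g ⊓ Subobject.mk j), Subobject.mk_eq_bot_iff_zero, h1]

namespace DimensionFunction

variable {d : DimensionFunction.{t} C} {α : Ordinal.{t}} {O E : C} {j : O ⟶ E}

/-- The injective hull of a critical object is uniform. -/
lemma IsCriticalOfDim.hull_uniform (h : d.IsCriticalOfDim α O) (hj : IsInjectiveHull j)
    {A B : C} (f : A ⟶ E) (g : B ⟶ E) [Mono f] [Mono g] (hA : ¬ IsZero A) (hB : ¬ IsZero B) :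
    ¬ IsZero (pullback f g) := by
  have := hj.mono
  intro h0
  refine h.not_isZero_pullback (pullback.snd f j) (pullback.snd g j)
    (hj.not_isZero_pullback f hA) (hj.not_isZero_pullback g hB) ?_
  let P := pullback (pullback.snd f j) (pullback.snd g j)
  let a : P ⟶ A := pullback.fst _ _ ≫ pullback.fst _ _
  let b : P ⟶ B := pullback.snd _ _ ≫ pullback.fst _ _
  have hab : a ≫ f = b ≫ g := by
    simp only [a, b, Category.assoc, pullback.condition]
    rw [pullback.condition_assoc]
  have ha : a = 0 := by
    rw [← pullback.lift_fst a b hab, h0.eq_of_src (pullback.fst f g) 0, comp_zero]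
  have : Mono a := inferInstance
  rw [IsZero.iff_id_eq_zero, ← cancel_mono a, ha, comp_zero, comp_zero]

lemma IsCriticalOfDim.hull_indecomposable (h : d.IsCriticalOfDim α O) (hj : IsInjectiveHull j) :
    Indecomposable E := by
  refine ⟨fun h0 => h.not_isZero ?_, fun Y Z e => ?_⟩
  · have := hj.mono
    rw [IsZero.iff_id_eq_zero, ← cancel_mono j]
    exact h0.eq_of_tgt _ _
  · by_contra! hYZ
    refine h.hull_uniform hj (biprod.inl ≫ e.inv) (biprod.inr ≫ e.inv) hYZ.1 hYZ.2 ?_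
    have h1 := pullback.condition (f := (biprod.inl : Y ⟶ Y ⊞ Z) ≫ e.inv)
      (g := (biprod.inr : Z ⟶ Y ⊞ Z) ≫ e.inv)
    rw [← Category.assoc, ← Category.assoc, cancel_mono] at h1
    have h2 := congrArg (· ≫ biprod.fst) h1
    simp only [Category.assoc, biprod.inl_fst, biprod.inr_fst, Category.comp_id,
      comp_zero] at h2
    rw [IsZero.iff_id_eq_zero, ← cancel_mono (pullback.fst _ _), h2, comp_zero, comp_zero]

lemma IsLargestCritical.factors {O' : Subobject E} (hO' : d.IsLargestCritical O')
    {N : C} (f : N ⟶ E) [Mono f] (hN : d.IsCritical N) : O'.Factors f := by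
  have h1 : Subobject.mk f ≤ O' := by
    refine hO'.2 ?_
    obtain ⟨β, hβ⟩ := hN
    exact ⟨β, hβ.of_iso (Subobject.underlyingIso f)⟩
  exact Subobject.factors_of_le _ h1 (Subobject.mk_factors_self f)

lemma IsLargestCritical.exists_mono (h : d.IsCriticalOfDim α O) (hj : IsInjectiveHull j)
    {O' : Subobject E} (hO' : d.IsLargestCritical O') :
    d.IsCriticalOfDim α (O' : C) ∧ ∃ k : O ⟶ (O' : C), Mono k ∧ k ≫ O'.arrow = j := by
  have := hj.mono
  have h1 := hO'.factors j ⟨α, h⟩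
  have h2 := O'.factorThru_arrow j h1
  have hk : Mono (O'.factorThru j h1) := mono_of_mono_fac h2
  obtain ⟨β, hβ⟩ : d.IsCritical (O' : C) := hO'.1
  obtain rfl := h.eq_of_common hβ (𝟙 O) (O'.factorThru j h1) h.not_isZero
  exact ⟨hβ, _, hk, h2⟩

/-- Injectivity of `E₂` extends `N ⟶ E₂` to `E`. The extension is mono because every nonzero kernel
would meet `N`, `E` being uniform. It carries `O'` to a critical subobject of `E₂`, which lies in
`O₂`. -/
lemma IsLargestCritical.exists_mono_of_common (h : d.IsCriticalOfDim α O)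
    (hj : IsInjectiveHull j) {O' : Subobject E} (hO' : d.IsLargestCritical O')
    {N E₂ : C} (i : N ⟶ O) [Mono i] (hN : ¬ IsZero N) (hE₂ : Injective E₂)
    {O₂ : Subobject E₂} (hO₂ : d.IsLargestCritical O₂) (i₂ : N ⟶ E₂) [Mono i₂] :
    ∃ k : (O' : C) ⟶ (O₂ : C), Mono k := by
  have := hj.mono
  let g : E ⟶ E₂ := Injective.factorThru i₂ (i ≫ j)
  have hg : (i ≫ j) ≫ g = i₂ := Injective.comp_factorThru _ _
  have hmono : Mono g := by
    by_contra hg'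
    refine h.hull_uniform hj (kernel.ι g) (i ≫ j)
      (fun h0 => hg' (Preadditive.mono_of_kernel_zero (h0.eq_of_src _ _))) hN ?_
    have h1 := congrArg (· ≫ g) (pullback.condition (f := kernel.ι g) (g := i ≫ j))
    simp only [Category.assoc, kernel.condition, comp_zero] at h1
    simp only [Category.assoc] at hg
    rw [hg] at h1
    have h2 : pullback.snd (kernel.ι g) (i ≫ j) = 0 := by
      rw [← cancel_mono i₂, ← h1, zero_comp]
    rw [IsZero.iff_id_eq_zero, ← cancel_mono (pullback.snd _ _), h2, comp_zero, comp_zero]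
  have h1 := hO₂.factors (O'.arrow ≫ g) hO'.1
  exact ⟨O₂.factorThru _ h1, mono_of_mono_fac (O₂.factorThru_arrow _ h1)⟩

end DimensionFunction

end Hull

section Grothendieck

variable {C : Type u} [Category.{v} C] [Abelian C] [IsGrothendieckAbelian.{v} C]

namespace DimensionFunction

variable {d : DimensionFunction.{t} C} {α : Ordinal.{t}} {O E : C} {j : O ⟶ E}

lemma IsCriticalOfDim.exists_largestCritical (h : d.IsCriticalOfDim α O)
    (hj : IsInjectiveHull j) (hα : IsLocalizing (d.lt α)) :
    ∃ O' : Subobject E, d.IsLargestCritical O' := by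
  have := hj.mono
  -- `O'` is the preimage of the largest subobject of `E/O` of dimension less than `α`, which exists
  -- because `C_{<α}` is localizing.
  obtain ⟨A, hA, hA'⟩ := exists_largest_subobject (d.lt α) hα.closedUnderCoproducts (cokernel j)
  let O' := (Subobject.pullback (cokernel.π j)).obj A
  have hj' : O'.Factors j := by
    rw [pullback_factors_iff, cokernel.condition]
    exact Subobject.factors_zero
  let k := O'.factorThru j hj'
  have hk : k ≫ O'.arrow = j := O'.factorThru_arrow j hj'
  have : Mono k := mono_of_mono_fac hk
  have hk' : d.dim (cokernel k) < α := by
    obtain ⟨f, _⟩ := exists_mono_cokernel k O'.arrow hk A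
      ((pullback_factors_iff _ _ _).1 (Subobject.factors_self _))
    exact (d.dim_le_of_mono f).trans_lt hA
  have hcrit : d.IsCriticalOfDim α (O' : C) := by
    refine h.of_essential k hk' fun N g _ hN h0 => ?_
    refine hj.not_isZero_pullback (g ≫ O'.arrow) hN ?_
    let l : pullback (g ≫ O'.arrow) j ⟶ pullback g k :=
      pullback.lift (pullback.fst _ _) (pullback.snd _ _) (by
        rw [← cancel_mono O'.arrow, Category.assoc, pullback.condition, Category.assoc, hk])
    have hl : l ≫ pullback.fst _ _ = pullback.fst _ _ := pullback.lift_fst _ _ _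
    rw [IsZero.iff_id_eq_zero, ← cancel_mono (pullback.fst _ _), ← hl, h0.eq_of_tgt l 0,
      zero_comp, comp_zero, comp_zero]
  refine ⟨O', ⟨α, hcrit⟩, fun K ⟨β, hβ⟩ => ?_⟩
  -- A critical `K ≤ E` meets `O` by uniformity, so it has dimension `α` and its image in `E/O` is a
  -- proper quotient, of smaller dimension.
  have hp := h.hull_uniform hj K.arrow j hβ.not_isZero h.not_isZero
  obtain rfl := h.eq_of_common hβ (pullback.snd K.arrow j) (pullback.fst K.arrow j) hp
  refine Subobject.le_of_factors ?_
  rw [pullback_factors_iff, ← Abelian.image.fac (K.arrow ≫ cokernel.π j)]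
  refine Subobject.factors_of_factors_right _ (hA' _ _ ?_)
  refine hβ.dim_lt_of_epi (Abelian.factorThruImage (K.arrow ≫ cokernel.π j)) fun hm => hp ?_
  have h1 : pullback.fst K.arrow j ≫ Abelian.factorThruImage (K.arrow ≫ cokernel.π j) = 0 := by
    rw [← cancel_mono (Abelian.image.ι _), Category.assoc, Abelian.image.fac,
      pullback.condition_assoc, cokernel.condition, comp_zero, zero_comp]
  have h2 : pullback.fst K.arrow j = 0 := by
    rw [← cancel_mono (Abelian.factorThruImage (K.arrow ≫ cokernel.π j)), h1, zero_comp]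
  rw [IsZero.iff_id_eq_zero, ← cancel_mono (pullback.fst K.arrow j), h2, comp_zero, comp_zero]

end DimensionFunction

end Grothendieck

/-! ### Critical objects generating the same weakly closed subspace -/

section Closure

variable {C : Type u} [Category.{v} C] [Abelian C]

instance epi_biprod_desc_sup {X : C} (A B : Subobject X) :
    Epi (biprod.desc (Subobject.ofLE A (A ⊔ B) le_sup_left)
      (Subobject.ofLE B (A ⊔ B) le_sup_right)) := by
  obtain ⟨T, e, _, a, b, ha, hb, hab⟩ :=
    exists_refinement_of_factors_sup (A ⊔ B).arrow (Subobject.factors_self _)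
  refine epi_of_epi_fac (f := biprod.lift (A.factorThru a ha) (B.factorThru b hb)) (h := e) ?_
  rw [← cancel_mono (A ⊔ B).arrow, hab, biprod.lift_desc]
  simp

end Closure

namespace DimensionFunction

section Share

variable {C : Type u} [Category.{v} C] [Abelian C] (d : DimensionFunction.{t} C)
  (α : Ordinal.{t}) (B : C)

/-- The objects all of whose `α`-critical subquotients share a nonzero subobject with `B`. -/
def Shares : ObjectProperty C := fun N =>
  ∀ (K Q : C) (i : K ⟶ N) (p : K ⟶ Q), Mono i → Epi p → d.IsCriticalOfDim α Q →
    ∃ (R : C) (a : R ⟶ Q) (b : R ⟶ B), Mono a ∧ Mono b ∧ ¬ IsZero R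

variable {d α B}

instance : (d.Shares α B).IsClosedUnderSubobjects where
  prop_of_mono f _ h K Q i p _ hp hQ := h K Q (i ≫ f) p inferInstance hp hQ

instance : (d.Shares α B).IsClosedUnderQuotients where
  prop_of_epi f _ h _ Q i p _ _ hQ :=
    h (pullback f i) Q (pullback.fst f i) (pullback.snd f i ≫ p) inferInstance
      (epi_comp _ _) hQ

lemma shares_of_isZero {N : C} (hN : IsZero N) : d.Shares α B N := by
  intro K Q i p _ _ hQ
  refine absurd ?_ hQ.not_isZero
  rw [IsZero.iff_id_eq_zero, ← cancel_epi p, comp_zero, Category.comp_id]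
  have : 𝟙 K = 0 := by rw [← cancel_mono i]; exact hN.eq_of_tgt _ _
  rw [← Category.id_comp p, this, zero_comp]

/-- A proper quotient of a subobject of `B` has dimension less than `α`, so an `α`-critical
subquotient of `B` is isomorphic to a subobject. -/
lemma IsCriticalOfDim.shares_self (hB : d.IsCriticalOfDim α B) : d.Shares α B B := by
  intro K Q i p hi hp hQ
  have hK : ¬ IsZero K := fun h0 => hQ.not_isZero (by
    rw [IsZero.iff_id_eq_zero, ← cancel_epi p]; exact h0.eq_of_src _ _)
  have : Mono p := by
    by_contra h
    exact ((hB.of_mono i hK).dim_lt_of_epi p h).ne hQ.1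
  exact ⟨K, p, i, this, hi, hK⟩

lemma shares_of_shortExact {S : ShortComplex C} (hS : S.ShortExact)
    (h₁ : d.Shares α B S.X₁) (h₃ : d.Shares α B S.X₃) : d.Shares α B S.X₂ := by
  have := hS.mono_f
  intro K Q i p hi hp hQ
  let c : pullback S.f i ⟶ Q := pullback.snd S.f i ≫ p
  -- If `K ∩ X₁` dies in `Q`, then `Q` is a quotient of the image of `K` in `X₃`; otherwise the
  -- image of `K ∩ X₁` is a critical subobject of `Q` that is a subquotient of `X₁`.
  by_cases hc : c = 0
  · let g : K ⟶ S.X₃ := i ≫ S.g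
    have hker : kernel.ι g ≫ p = 0 := by
      let l : kernel g ⟶ S.X₁ := hS.exact.lift (kernel.ι g ≫ i) (by
        rw [Category.assoc]; exact kernel.condition g)
      have hl : l ≫ S.f = kernel.ι g ≫ i := hS.exact.lift_f _ _
      rw [← pullback.lift_snd l (kernel.ι g) hl, Category.assoc]
      exact (congrArg _ hc).trans comp_zero
    let q : Abelian.image g ⟶ Q := Abelian.epiDesc (Abelian.factorThruImage g) p (by
      have h1 : kernel.ι (Abelian.factorThruImage g) ≫ g = 0 := by
        refine (congrArg (kernel.ι (Abelian.factorThruImage g) ≫ ·)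
          (Abelian.image.fac g)).symm.trans ?_
        simp only [kernel.condition_assoc, zero_comp]
      rw [← kernel.lift_ι g _ h1, Category.assoc, hker, comp_zero])
    have hq : Abelian.factorThruImage g ≫ q = p := Abelian.comp_epiDesc _ _ _
    exact h₃ _ Q (Abelian.image.ι g) q inferInstance (epi_of_epi_fac hq) hQ
  · have hQ' : d.IsCriticalOfDim α (Abelian.image c) :=
      hQ.of_mono (Abelian.image.ι c) fun h0 => hc (by
        rw [← Abelian.image.fac c, h0.eq_of_src (Abelian.image.ι c) 0, comp_zero])
    obtain ⟨R, a, b, _, hb, hR⟩ := h₁ _ _ (pullback.fst S.f i) (Abelian.factorThruImage c)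
      inferInstance inferInstance hQ'
    exact ⟨R, a ≫ Abelian.image.ι c, b, inferInstance, hb, hR⟩

lemma shares_biprod {X Y : C} (hX : d.Shares α B X) (hY : d.Shares α B Y) :
    d.Shares α B (X ⊞ Y) :=
  shares_of_shortExact (S := ShortComplex.mk (biprod.inl : X ⟶ X ⊞ Y) biprod.snd (by simp))
    (ShortComplex.Splitting.ofHasBinaryBiproduct X Y).shortExact hX hY

lemma shares_sup {X : C} {A₁ A₂ : Subobject X} (h₁ : d.Shares α B (A₁ : C))
    (h₂ : d.Shares α B (A₂ : C)) : d.Shares α B ((A₁ ⊔ A₂ : Subobject X) : C) :=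
  (d.Shares α B).prop_of_epi (biprod.desc (Subobject.ofLE A₁ (A₁ ⊔ A₂) le_sup_left)
      (Subobject.ofLE A₂ (A₁ ⊔ A₂) le_sup_right)) (shares_biprod h₁ h₂)

end Share

section Grothendieck

variable {C : Type u} [Category.{v} C] [Abelian C] [IsGrothendieckAbelian.{v} C]
  {d : DimensionFunction.{t} C} {α : Ordinal.{t}} {B : C}

/-- A direct sum is the directed union of its finite partial sums. By AB5 a nonzero `p` is nonzero
on the part of `K` inside some partial sum, and its image there is a critical subobject of `Q`. -/
lemma shares_of_isColimit {ι : Type v} {F : Discrete ι ⥤ C} {c : Cocone F} (hc : IsColimit c)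
    (hF : ∀ i, d.Shares α B (F.obj i)) : d.Shares α B c.pt := by
  classical
  let T (i : ι) : Subobject c.pt := imageSubobject (c.ι.app ⟨i⟩)
  let S (J : Finset ι) : Subobject c.pt := J.sup T
  have hS (J : Finset ι) : d.Shares α B (S J : C) := by
    induction J using Finset.induction_on with
    | empty =>
      refine shares_of_isZero ?_
      rw [← subobject_eq_bot_iff_isZero]
      rfl
    | insert i J _ hJ =>
      have : S (insert i J) = T i ⊔ S J := Finset.sup_insert
      rw [this]
      exact shares_sup ((d.Shares α B).prop_of_epi (factorThruImageSubobject (c.ι.app ⟨i⟩))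
        (hF ⟨i⟩)) hJ
  have htop : sSup (Set.range S) = ⊤ := by
    have h0 : cokernel.π (sSup (Set.range S)).arrow = 0 := by
      refine hc.hom_ext fun ⟨i⟩ => ?_
      rw [comp_zero]
      have h1 : T i ≤ sSup (Set.range S) :=
        le_trans (by simp [S]) (le_sSup (Set.mem_range_self {i}))
      rw [← factors_iff_comp_cokernel_eq_zero]
      exact Subobject.factors_of_le _ h1 ((Subobject.factors_iff _ _).2
        ⟨factorThruImageSubobject _, imageSubobject_arrow_comp _⟩)
    have : Epi (sSup (Set.range S)).arrow := Preadditive.epi_of_cokernel_zero h0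
    rw [← Subobject.isIso_arrow_iff_eq_top]
    exact isIso_of_mono_of_epi _
  intro K Q i p hi hp hQ
  by_contra hR
  have hp0 : p = 0 := by
    refine eq_zero_of_directed_sSup (Set.range S) (Set.range_nonempty S) ?_ i
      (by rw [htop]; exact Subobject.top_factors _) p ?_
    · rintro _ ⟨J, rfl⟩ _ ⟨J', rfl⟩
      exact ⟨_, ⟨J ∪ J', rfl⟩, Finset.sup_mono Finset.subset_union_left,
        Finset.sup_mono Finset.subset_union_right⟩
    · rintro _ ⟨J, rfl⟩
      by_contra hne
      let q := ((Subobject.pullback i).obj (S J)).arrow ≫ p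
      have hQ' : d.IsCriticalOfDim α (Abelian.image q) :=
        hQ.of_mono (Abelian.image.ι q) fun h0 => hne (by
          change q = 0
          rw [← Abelian.image.fac q, h0.eq_of_src (Abelian.image.ι q) 0, comp_zero])
      have hm : Mono (Subobject.pullbackπ i (S J)) := by
        have := (Subobject.isPullback i (S J)).w
        have : Mono (Subobject.pullbackπ i (S J) ≫ (S J).arrow) := by
          rw [this]; infer_instance
        exact mono_of_mono _ (S J).arrow
      obtain ⟨R, a, b, _, hb, hR'⟩ := hS J _ _ (Subobject.pullbackπ i (S J))
        (Abelian.factorThruImage q) hm inferInstance hQ'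
      exact hR ⟨R, a ≫ Abelian.image.ι q, b, inferInstance, hb, hR'⟩
  refine hQ.not_isZero ?_
  rw [IsZero.iff_id_eq_zero, ← cancel_epi p, hp0, zero_comp, zero_comp]

instance : IsWeaklyClosed (d.Shares α B) where
  closedUnderCoproducts ι := ⟨by
    rintro N ⟨⟨F, c, hc⟩, hF⟩
    exact shares_of_isColimit hc hF⟩

/-- Critical objects generating the same weakly closed subspace share a nonzero subobject. -/
lemma exists_common_of_sigma
    (hd : ∀ (α : Ordinal.{t}) (M : C), d.IsCriticalOfDim α M → IsLocalizing (d.lt α))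
    {A : C} (hA : d.IsCritical A) (hB : d.IsCritical B) (hAB : sigma B A) (hBA : sigma A B) :
    ∃ (R : C) (a : R ⟶ A) (b : R ⟶ B), Mono a ∧ Mono b ∧ ¬ IsZero R := by
  have key {A B : C} {α β : Ordinal.{t}} (hA : d.IsCriticalOfDim α A)
      (hB : d.IsCriticalOfDim β B) (hAB : sigma B A) : α ≤ β := by
    -- If `β < α`, then `C_{<α}` would be a weakly closed subspace containing `B` but not `A`.
    by_contra! hlt
    have := hd α A hA
    have h1 : IsWeaklyClosed (d.lt α) := { closedUnderCoproducts := this.closedUnderCoproducts }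
    have h2 : d.lt α A := hAB _ h1 (by
      rw [lt, hB.1]
      exact_mod_cast hlt)
    exact h2.ne hA.1
  obtain ⟨α, hA⟩ := hA
  obtain ⟨β, hB⟩ := hB
  obtain rfl := le_antisymm (key hA hB hAB) (key hB hA hBA)
  exact hAB (d.Shares α B) inferInstance hB.shares_self A A (𝟙 A) (𝟙 A) inferInstance
    inferInstance hA

end Grothendieck

end DimensionFunction

/-! ### Transport of finiteness of Hom and of noetherianity -/

section Tiny

variable {D : Type*} [Category* D] [Preadditive D] {D' : Type*} [Category* D'] [Preadditive D']

lemma finite_hom_of_surjective {N S : D} {N' S' : D'} (σ : End S →+* End S')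
    (hσ : Function.Surjective σ) (φ : (N ⟶ S) →+ (N' ⟶ S')) (hφ : Function.Surjective φ)
    (h : ∀ (f : N ⟶ S) (a : End S), φ (f ≫ a) = φ f ≫ σ a) (hN : Module.Finite (End S) (N ⟶ S)) :
    Module.Finite (End S') (N' ⟶ S') := by
  have : RingHomSurjective σ := ⟨hσ⟩
  exact Module.Finite.of_surjective (σ := σ)
    { toFun := φ, map_add' := φ.map_add, map_smul' := fun a f => h f a } hφ

lemma finite_hom_of_iso {N N' S S' : D} (e : N ≅ N') (e' : S ≅ S')
    (hN : Module.Finite (End S) (N ⟶ S)) : Module.Finite (End S') (N' ⟶ S') := by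
  refine finite_hom_of_surjective
    { toFun := fun a => e'.inv ≫ a ≫ e'.hom
      map_one' := by simp
      map_mul' := fun a b => by simp [End.mul_def]
      map_zero' := by
        change e'.inv ≫ (0 : S ⟶ S) ≫ e'.hom = 0
        simp
      map_add' := fun a b => by
        change e'.inv ≫ ((show S ⟶ S from a) + (show S ⟶ S from b)) ≫ e'.hom = _
        simp }
    (fun b => ⟨e'.hom ≫ b ≫ e'.inv, by simp⟩)
    { toFun := fun f => e.inv ≫ f ≫ e'.hom, map_zero' := by simp, map_add' := by simp }
    (fun b => ⟨e.hom ≫ b ≫ e'.inv, by simp⟩) ?_ hN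
  intro f a
  simp

lemma isTinyObject_of_iso {S S' : D} (e : S ≅ S') (h : IsTinyObject S) : IsTinyObject S' :=
  fun N hN => finite_hom_of_iso (Iso.refl N) e (h N hN)

lemma finite_hom_map_iff (F : D ⥤ D') [F.Additive] [F.Full] [F.Faithful] (N S : D) :
    Module.Finite (End S) (N ⟶ S) ↔ Module.Finite (End (F.obj S)) (F.obj N ⟶ F.obj S) := by
  constructor
  · refine finite_hom_of_surjective
      { toFun := fun a => F.map a
        map_one' := F.map_id _
        map_mul' := fun a b => by simp [End.mul_def]
        map_zero' := F.map_zero _ _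
        map_add' := fun a b => F.map_add (f := a) (g := b) } (fun b => F.map_surjective b)
      F.mapAddHom (fun b => F.map_surjective b) (fun f a => F.map_comp f a)
  · refine finite_hom_of_surjective
      { toFun := fun a => F.preimage a
        map_one' := F.preimage_id
        map_mul' := fun a b => F.preimage_comp b a
        map_zero' := F.map_injective ?_
        map_add' := fun a b => F.map_injective ?_ } (fun b => ⟨F.map b, F.preimage_map b⟩)
      { toFun := fun f => F.preimage f
        map_zero' := F.map_injective (by simp)
        map_add' := fun a b => F.map_injective (by simp) } (fun b => ⟨F.map b, F.preimage_map b⟩)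
      (fun f a => F.preimage_comp f a)
    · exact (F.map_preimage _).trans (F.map_zero _ _).symm
    · refine (F.map_preimage _).trans (Eq.trans ?_ (F.map_add ..).symm)
      rw [F.map_preimage, F.map_preimage]

lemma isNoetherianObject_of_strictMono {A : Type*} [Category* A] {B : Type*} [Category* B]
    {X : A} {Y : B} (φ : Subobject X → Subobject Y) (hφ : StrictMono φ)
    (hY : IsNoetherianObject Y) : IsNoetherianObject X := by
  rw [isNoetherianObject_iff_not_strictMono] at hY ⊢
  exact fun f hf => hY _ (hφ.comp hf)

lemma isNoetherianObject_of_map {A : Type*} [Category* A] {B : Type*} [Category* B]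
    (F : A ⥤ B) [F.Full] [F.Faithful] [F.PreservesMonomorphisms] {X : A}
    (hX : IsNoetherianObject (F.obj X)) : IsNoetherianObject X := by
  have key (G G' : Subobject X) : Subobject.mk (F.map G.arrow) ≤ Subobject.mk (F.map G'.arrow) ↔
      G ≤ G' := by
    constructor
    · intro h
      refine Subobject.le_of_comm (F.preimage (Subobject.ofMkLEMk _ _ h)) (F.map_injective ?_)
      rw [F.map_comp, F.map_preimage, Subobject.ofMkLEMk_comp]
    · intro h
      exact Subobject.mk_le_mk_of_comm (F.map (Subobject.ofLE _ _ h)) (by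
        rw [← F.map_comp, Subobject.ofLE_arrow])
  refine isNoetherianObject_of_strictMono (fun G => Subobject.mk (F.map G.arrow)) ?_ hX
  intro G G' h
  exact lt_of_le_not_ge ((key _ _).2 h.le) (fun h' => h.not_ge ((key _ _).1 h'))

/-- The hypothesis says that subobjects of `F.obj X` come from subobjects of `X`, so ascending
chains lift. -/
lemma isNoetherianObject_map {A : Type*} [Category* A] {B : Type*} [Category* B]
    (F : A ⥤ B) [F.Full] [F.Faithful] [F.PreservesMonomorphisms] {X : A}
    (hF : ∀ (Y : B) (g : Y ⟶ F.obj X) [Mono g], ∃ (Z : A) (i : Z ⟶ X) (_ : Mono i)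
      (e : F.obj Z ≅ Y), e.hom ≫ g = F.map i)
    (hX : IsNoetherianObject X) : IsNoetherianObject (F.obj X) := by
  have h (G : Subobject (F.obj X)) : ∃ G' : Subobject X, Subobject.mk (F.map G'.arrow) = G := by
    obtain ⟨Z, i, _, e, he⟩ := hF _ G.arrow
    refine ⟨Subobject.mk i, ?_⟩
    rw [← Subobject.mk_arrow G]
    refine Subobject.mk_eq_mk_of_comm _ _ (F.mapIso (Subobject.underlyingIso i) ≪≫ e) ?_
    rw [Iso.trans_hom, Category.assoc, he, Functor.mapIso_hom, ← F.map_comp,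
      Subobject.underlyingIso_hom_comp_eq_mk]
  choose φ hφ using h
  refine isNoetherianObject_of_strictMono φ ?_ hX
  intro G G' h
  have key {G G' : Subobject (F.obj X)} (h : G ≤ G') : φ G ≤ φ G' := by
    have h' : Subobject.mk (F.map (φ G).arrow) ≤ Subobject.mk (F.map (φ G').arrow) := by
      rwa [hφ, hφ]
    refine Subobject.le_of_comm (F.preimage (Subobject.ofMkLEMk _ _ h')) (F.map_injective ?_)
    rw [F.map_comp, F.map_preimage, Subobject.ofMkLEMk_comp]
  refine lt_of_le_of_ne (key h.le) fun h' => h.ne ?_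
  rw [← hφ G, ← hφ G', h']

end Tiny

section AbelianTiny

variable {D : Type*} [Category* D] [Abelian D]

lemma isNoetherianObject_of_epi {X Y : D} (p : X ⟶ Y) [Epi p] (hX : IsNoetherianObject X) :
    IsNoetherianObject Y := by
  refine isNoetherianObject_of_strictMono (Subobject.pullback p).obj ?_ hX
  refine (Subobject.pullback p).monotone.strictMono_of_injective ?_
  have key {A B : Subobject Y}
      (h : (Subobject.pullback p).obj A ≤ (Subobject.pullback p).obj B) : A ≤ B := by
    refine Subobject.le_of_factors ?_
    refine factors_of_epi_comp (pullback.snd p A.arrow) _ ?_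
    rw [← pullback.condition, ← pullback_factors_iff]
    refine Subobject.factors_of_le _ h ?_
    rw [pullback_factors_iff, pullback.condition]
    exact Subobject.factors_comp_arrow _
  exact fun A B h => le_antisymm (key h.le) (key h.ge)

lemma isNoetherianRing_end_of_simple (S : D) [Simple S] : IsNoetherianRing (End S) :=
  inferInstance

/-- Hom into `S` is left exact, and Schur's lemma makes `End S` noetherian, so finiteness passes to
the middle term. -/
lemma finite_hom_of_shortExact {T : ShortComplex D} (hT : T.ShortExact) (S : D) [Simple S]
    (h₁ : Module.Finite (End S) (T.X₁ ⟶ S)) (h₃ : Module.Finite (End S) (T.X₃ ⟶ S)) :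
    Module.Finite (End S) (T.X₂ ⟶ S) := by
  have := isNoetherianRing_end_of_simple S
  let g : (T.X₃ ⟶ S) →ₗ[End S] (T.X₂ ⟶ S) :=
    { toFun := fun f => T.g ≫ f
      map_add' := fun a b => Preadditive.comp_add _ _ _ _ _ _
      map_smul' := fun a f => (Category.assoc _ _ _).symm }
  let f : (T.X₂ ⟶ S) →ₗ[End S] (T.X₁ ⟶ S) :=
    { toFun := fun f => T.f ≫ f
      map_add' := fun a b => Preadditive.comp_add _ _ _ _ _ _
      map_smul' := fun a f => (Category.assoc _ _ _).symm }
  have hgf : LinearMap.range g = LinearMap.ker f := by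
    ext a
    simp only [LinearMap.mem_range, LinearMap.mem_ker]
    constructor
    · rintro ⟨b, rfl⟩
      change T.f ≫ T.g ≫ b = 0
      rw [T.zero_assoc, zero_comp]
    · intro ha
      have := hT.epi_g
      exact ⟨hT.exact.desc a ha, hT.exact.g_desc a ha⟩
  have : IsNoetherian (End S) (T.X₂ ⟶ S) := isNoetherian_of_range_eq_ker g f hgf
  infer_instance

end AbelianTiny

open ObjectProperty.SerreClassLocalization

/-! ### Serre quotients of a subspace and of the ambient category -/

section Localization

variable {C : Type*} [Category* C] [Abelian C] {D : Type*} [Category* D] [Preadditive D]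
  (L : C ⥤ D) (T : ObjectProperty C) [T.IsSerreClass] [L.IsLocalization T.isoModSerre]
  [L.Additive]

include T in
-- Write `g` as a fraction. Its numerator becomes mono after localization, hence agrees there with
-- the inclusion of its image.
lemma exists_iso_of_mono_localization {X : C} {Y : D} (g : Y ⟶ L.obj X) [Mono g] :
    ∃ (Z : C) (i : Z ⟶ X) (_ : Mono i) (e : L.obj Z ≅ Y), e.hom ≫ g = L.map i := by
  have := Localization.essSurj L T.isoModSerre
  obtain ⟨φ, hφ⟩ := Localization.exists_rightFraction L T.isoModSerre
    ((L.objObjPreimageIso Y).hom ≫ g)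
  have h1 : L.map φ.s ≫ (L.objObjPreimageIso Y).hom ≫ g = L.map φ.f := by
    rw [hφ, MorphismProperty.RightFraction.map_s_comp_map]
  have hs := Localization.inverts L T.isoModSerre _ φ.hs
  have hmono : Mono (L.map φ.f) := by
    rw [← h1]
    infer_instance
  have := Localization.inverts L T.isoModSerre _
    ((mono_map_iff L T φ.f).1 hmono).isoModSerre_factorThruImage
  refine ⟨Abelian.image φ.f, Abelian.image.ι φ.f, inferInstance,
    (asIso (L.map (Abelian.factorThruImage φ.f))).symm ≪≫ asIso (L.map φ.s) ≪≫
      L.objObjPreimageIso Y, ?_⟩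
  simp only [Iso.trans_hom, Iso.symm_hom, asIso_inv, asIso_hom, Category.assoc]
  rw [h1, IsIso.inv_comp_eq, ← L.map_comp, Abelian.image.fac]

end Localization

section Restriction

variable {C : Type u} [Category.{v} C] [Abelian C] (Z : ObjectProperty C) [IsWeaklyClosed Z]
  (T : ObjectProperty C) [T.IsSerreClass]
  (TZ : ObjectProperty Z.FullSubcategory) [TZ.IsSerreClass]
  {DZ : Type*} [Category* DZ] {D : Type*} [Category* D]
  (LZ : Z.FullSubcategory ⥤ DZ) (L : C ⥤ D) [LZ.IsLocalization TZ.isoModSerre]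
  [L.IsLocalization T.isoModSerre]

lemma isoModSerre_restrict (hT : ∀ M, TZ M ↔ T M.obj) {M N : Z.FullSubcategory} (f : M ⟶ N) :
    TZ.isoModSerre f ↔ T.isoModSerre f.hom := by
  have := Z.preservesKernels_ι
  have := Z.preservesCokernels_ι
  refine and_congr ?_ ?_
  · exact (hT _).trans (T.prop_iff_of_iso (PreservesKernel.iso Z.ι f))
  · exact (hT _).trans (T.prop_iff_of_iso (PreservesCokernel.iso Z.ι f))

variable (F : DZ ⥤ D) (e : LZ ⋙ F ≅ Z.ι ⋙ L)

include e T TZ in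
lemma full_of_localization (hT : ∀ M, TZ M ↔ T M.obj) : F.Full := by
  have := Localization.essSurj LZ TZ.isoModSerre
  have key {A B : Z.FullSubcategory} (f : F.obj (LZ.obj A) ⟶ F.obj (LZ.obj B)) :
      ∃ g, F.map g = f := by
    obtain ⟨φ, hφ⟩ := Localization.exists_rightFraction L T.isoModSerre
      (e.inv.app A ≫ f ≫ e.hom.app B)
    have h1 : L.map φ.s ≫ e.inv.app A ≫ f ≫ e.hom.app B = L.map φ.f := by
      rw [hφ, MorphismProperty.RightFraction.map_s_comp_map]
    let AB : Z.FullSubcategory := A ⊞ B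
    -- The apex of the fraction need not lie in `Z`. Its image in `A ⊞ B` does, and represents the
    -- same fraction, because the kernel of `r` lies in that of `φ.s`, which belongs to `T`.
    let r : φ.X' ⟶ AB.obj := φ.s ≫ (biprod.inl : A ⟶ A ⊞ B).hom + φ.f ≫ (biprod.inr : B ⟶ A ⊞ B).hom
    let I : Z.FullSubcategory := ⟨Abelian.image r, Z.prop_of_mono (Abelian.image.ι r) AB.property⟩
    let ι : I ⟶ AB := Z.homMk (Abelian.image.ι r)
    let s : I ⟶ A := ι ≫ biprod.fst
    let g : I ⟶ B := ι ≫ biprod.snd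
    have hr : Abelian.factorThruImage r ≫ Abelian.image.ι r = r := Abelian.image.fac r
    have hs : Abelian.factorThruImage r ≫ s.hom = φ.s := by
      have h2 : (biprod.inl : A ⟶ A ⊞ B).hom ≫ (biprod.fst : A ⊞ B ⟶ A).hom = 𝟙 _ :=
        congrArg (fun k => k.hom) (biprod.inl_fst (X := A) (Y := B))
      have h3 : (biprod.inr : B ⟶ A ⊞ B).hom ≫ (biprod.fst : A ⊞ B ⟶ A).hom = 0 :=
        congrArg (fun k => k.hom) (biprod.inr_fst (X := A) (Y := B))
      calc Abelian.factorThruImage r ≫ Abelian.image.ι r ≫ (biprod.fst : A ⊞ B ⟶ A).hom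
          = r ≫ (biprod.fst : A ⊞ B ⟶ A).hom := by rw [← Category.assoc, hr]
        _ = φ.s := by
          simp only [r, Preadditive.add_comp, Category.assoc]
          rw [h2, h3]
          exact (congrArg₂ (fun x y : φ.X' ⟶ A.obj => x + y)
            (Category.comp_id _) comp_zero).trans (add_zero _)
    have hg : Abelian.factorThruImage r ≫ g.hom = φ.f := by
      have h2 : (biprod.inl : A ⟶ A ⊞ B).hom ≫ (biprod.snd : A ⊞ B ⟶ B).hom = 0 :=
        congrArg (fun k => k.hom) (biprod.inl_snd (X := A) (Y := B))
      have h3 : (biprod.inr : B ⟶ A ⊞ B).hom ≫ (biprod.snd : A ⊞ B ⟶ B).hom = 𝟙 _ :=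
        congrArg (fun k => k.hom) (biprod.inr_snd (X := A) (Y := B))
      calc Abelian.factorThruImage r ≫ Abelian.image.ι r ≫ (biprod.snd : A ⊞ B ⟶ B).hom
          = r ≫ (biprod.snd : A ⊞ B ⟶ B).hom := by rw [← Category.assoc, hr]
        _ = φ.f := by
          simp only [r, Preadditive.add_comp, Category.assoc]
          rw [h2, h3]
          exact (congrArg₂ (fun x y : φ.X' ⟶ B.obj => x + y)
            comp_zero (Category.comp_id _)).trans (zero_add _)
    have hW : T.isoModSerre (Abelian.factorThruImage r) := by
      refine T.isoModSerre_of_epi _ ?_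
      have h3 : kernel.ι (Abelian.factorThruImage r) ≫ φ.s = 0 := by
        rw [← hs, kernel.condition_assoc, zero_comp]
      exact T.prop_of_mono (kernel.lift _ _ h3) φ.hs.1
    have hW' : TZ.isoModSerre s := by
      rw [isoModSerre_restrict Z T TZ hT]
      refine (T.isoModSerre.precomp_iff _ _ hW).1 ?_
      rw [hs]
      exact φ.hs
    have := Localization.inverts LZ TZ.isoModSerre _ hW'
    have := Localization.inverts L T.isoModSerre _ hW
    refine ⟨inv (LZ.map s) ≫ LZ.map g, ?_⟩
    rw [F.map_comp, Functor.map_inv, IsIso.inv_comp_eq]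
    have ng : F.map (LZ.map g) ≫ e.hom.app B = e.hom.app I ≫ L.map g.hom := e.hom.naturality g
    have ns : F.map (LZ.map s) ≫ e.hom.app A = e.hom.app I ≫ L.map s.hom := e.hom.naturality s
    have h4 : L.map g.hom = L.map s.hom ≫ e.inv.app A ≫ f ≫ e.hom.app B := by
      rw [← cancel_epi (L.map (Abelian.factorThruImage r)), ← L.map_comp, hg, ← h1, ← hs,
        L.map_comp, Category.assoc]
    have h5 : F.map (LZ.map g) ≫ e.hom.app B = (F.map (LZ.map s) ≫ f) ≫ e.hom.app B := by
      rw [ng, h4]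
      have h6 : e.hom.app A ≫ e.inv.app A = 𝟙 _ := e.hom_inv_id_app A
      calc e.hom.app I ≫ L.map s.hom ≫ e.inv.app A ≫ f ≫ e.hom.app B
          = (e.hom.app I ≫ L.map s.hom) ≫ e.inv.app A ≫ f ≫ e.hom.app B := by
            rw [Category.assoc]
        _ = F.map (LZ.map s) ≫ (e.hom.app A ≫ e.inv.app A) ≫ f ≫ e.hom.app B := by
            rw [← ns, Category.assoc, Category.assoc]
        _ = _ := by
            rw [h6]
            exact (congrArg (_ ≫ ·) (Category.id_comp _)).trans (Category.assoc _ _ _).symm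
    exact (cancel_mono (e.hom.app B)).1 h5
  refine ⟨fun {X Y} f => ?_⟩
  obtain ⟨g, hg⟩ := key (F.map (LZ.objObjPreimageIso X).hom ≫ f ≫
    F.map (LZ.objObjPreimageIso Y).inv)
  refine ⟨(LZ.objObjPreimageIso X).inv ≫ g ≫ (LZ.objObjPreimageIso Y).hom, ?_⟩
  rw [F.map_comp, F.map_comp, hg]
  simp only [Category.assoc, ← F.map_comp, Iso.inv_hom_id, F.map_id, Category.comp_id]
  rw [← F.map_comp_assoc, Iso.inv_hom_id, F.map_id, Category.id_comp]

variable [Preadditive D] [L.Additive]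

include e T TZ in
lemma exists_iso_of_mono_restrict {X : DZ} {Y : D} (g : Y ⟶ F.obj X) [Mono g] (hfull : F.Full)
    (hfaith : F.Faithful) :
    ∃ (W : DZ) (i : W ⟶ X) (_ : Mono i) (k : F.obj W ≅ Y), k.hom ≫ g = F.map i := by
  have := Localization.essSurj LZ TZ.isoModSerre
  let X₀ := LZ.objPreimage X
  let x : LZ.obj X₀ ≅ X := LZ.objObjPreimageIso X
  obtain ⟨W, i, hi, k, hk⟩ := exists_iso_of_mono_localization L T
    (g ≫ F.map x.inv ≫ e.hom.app X₀)
  let W₀ : Z.FullSubcategory := ⟨W, Z.prop_of_mono i X₀.property⟩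
  let i₀ : W₀ ⟶ X₀ := Z.homMk i
  let k' : F.obj (LZ.obj W₀) ≅ Y := e.app W₀ ≪≫ k
  have hk' : k'.hom ≫ g = F.map (LZ.map i₀ ≫ x.hom) := by
    have h1 : e.hom.app W₀ ≫ L.map i = F.map (LZ.map i₀) ≫ e.hom.app X₀ :=
      (e.hom.naturality i₀).symm
    rw [← hk] at h1
    have h2 : (e.hom.app W₀ ≫ k.hom ≫ g ≫ F.map x.inv) ≫ e.hom.app X₀ =
        F.map (LZ.map i₀) ≫ e.hom.app X₀ := by
      rw [← h1]
      simp only [Category.assoc]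
    have h3 : e.hom.app W₀ ≫ k.hom ≫ g ≫ F.map x.inv = F.map (LZ.map i₀) :=
      (cancel_mono (e.hom.app X₀)).1 h2
    rw [F.map_comp, ← h3]
    simp only [k', Iso.trans_hom, Iso.app_hom, Category.assoc, ← F.map_comp, Iso.inv_hom_id,
      F.map_id]
    exact congrArg (_ ≫ ·) (congrArg (_ ≫ ·) (Category.comp_id _).symm)
  refine ⟨LZ.obj W₀, LZ.map i₀ ≫ x.hom, ?_, k', hk'⟩
  have : Mono (F.map (LZ.map i₀ ≫ x.hom)) := by
    rw [← hk']
    infer_instance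
  exact F.mono_of_mono_map this

variable [Preadditive DZ] [LZ.Additive]

include e TZ in
lemma additive_of_localization : F.Additive := by
  have : (LZ ⋙ F).Additive := Functor.additive_of_iso e.symm
  exact (Localization.functor_additive_iff LZ TZ.isoModSerre F).2 this

include e T TZ in
-- A morphism of `Z` dies in either quotient exactly when its image is torsion, and torsion in `Z`
-- is torsion in the ambient category. Fractions reduce the general case to this one.
lemma faithful_of_localization (hT : ∀ M, TZ M ↔ T M.obj) : F.Faithful := by
  have := additive_of_localization Z TZ LZ L F e
  have := Localization.essSurj LZ TZ.isoModSerre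
  have key {A B : Z.FullSubcategory} (f : A ⟶ B) (h : F.map (LZ.map f) = 0) : LZ.map f = 0 := by
    have h1 : L.map f.hom = 0 := by
      have h2 := e.hom.naturality f
      simp only [Functor.comp_map, h, zero_comp] at h2
      have h3 : e.hom.app A ≫ L.map f.hom = 0 := h2.symm
      rwa [Preadditive.IsIso.comp_left_eq_zero] at h3
    rw [map_eq_zero_iff LZ TZ, hT]
    rw [← Abelian.image.fac f] at h1
    have : Mono (Abelian.image.ι f).hom := inferInstance
    have : Epi (Abelian.factorThruImage f).hom := inferInstance
    rw [← map_comp_eq_zero_iff_of_epi_mono L T (Abelian.factorThruImage f).hom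
      (Abelian.image.ι f).hom, ← L.map_comp]
    exact h1
  refine ⟨fun {X Y} a b hab => ?_⟩
  rw [← sub_eq_zero] at hab ⊢
  rw [← F.map_sub] at hab
  generalize a - b = c at hab
  obtain ⟨φ, hφ⟩ := Localization.exists_rightFraction LZ TZ.isoModSerre
    ((LZ.objObjPreimageIso X).hom ≫ c ≫ (LZ.objObjPreimageIso Y).inv)
  have h1 : LZ.map φ.s ≫ (LZ.objObjPreimageIso X).hom ≫ c ≫ (LZ.objObjPreimageIso Y).inv
      = LZ.map φ.f := by
    rw [hφ, MorphismProperty.RightFraction.map_s_comp_map]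
  have h2 : LZ.map φ.f = 0 := by
    refine key _ ?_
    rw [← h1]
    simp [hab]
  have hs := Localization.inverts LZ TZ.isoModSerre _ φ.hs
  rw [h2] at h1
  simpa using h1

include e T TZ in
lemma preservesMonomorphisms_of_localization : F.PreservesMonomorphisms where
  preserves f hf := by
    obtain ⟨X', Y', f', _, ⟨i⟩⟩ := (mono_iff LZ TZ f).1 hf
    have := preservesMonomorphisms L T
    refine ((MorphismProperty.monomorphisms D).arrow_mk_iso_iff (F.mapArrow.mapIso i)).1 ?_
    refine ((MorphismProperty.monomorphisms D).arrow_mk_iso_iff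
      (Arrow.isoMk (e.app X') (e.app Y') (e.hom.naturality f').symm :
        Arrow.mk (F.map (LZ.map f')) ≅ Arrow.mk (L.map f'.hom))).2 ?_
    exact inferInstanceAs (Mono (L.map f'.hom))

end Restriction

open ObjectProperty.SerreClassLocalization

section Localization

variable {C : Type*} [Category* C] [Abelian C] {D : Type*} [Category* D] [Preadditive D]
  (L : C ⥤ D) (T : ObjectProperty C) [T.IsSerreClass] [L.IsLocalization T.isoModSerre]
  [L.Additive]

include T in
lemma finite_hom_localization_of_shortExact {S : ShortComplex C} (hS : S.ShortExact) (X : D)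
    [Simple X] (h₁ : Module.Finite (End X) (L.obj S.X₁ ⟶ X))
    (h₃ : Module.Finite (End X) (L.obj S.X₃ ⟶ X)) :
    Module.Finite (End X) (L.obj S.X₂ ⟶ X) := by
  let := abelian L T
  have := preservesFiniteLimits L T
  have := preservesFiniteColimits L T
  exact finite_hom_of_shortExact (hS.map_of_exact L) X h₁ h₃

include T in
lemma isNoetherianObject_localization_of_epi {X Y : C} (p : X ⟶ Y) [Epi p]
    (hX : IsNoetherianObject (L.obj X)) : IsNoetherianObject (L.obj Y) := by
  let := abelian L T
  have := preservesEpimorphisms L T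
  exact isNoetherianObject_of_epi (L.map p) hX

include T in
lemma isNoetherianObject_localization_of_mono {X Y : C} (p : X ⟶ Y) [Mono p]
    (hY : IsNoetherianObject (L.obj Y)) : IsNoetherianObject (L.obj X) := by
  have := preservesMonomorphisms L T
  exact isNoetherianObject_of_mono (L.map p)

end Localization

/-! ### Tininess and the comparison of quotient categories -/

namespace DimensionFunction

section Critical

variable {C : Type u} [Category.{v} C] [Abelian C] {d : DimensionFunction.{t} C}
  {α : Ordinal.{t}} {M : C} {D : Type*} [Category* D]
  (L : C ⥤ D) [L.IsLocalization (d.lt α).isoModSerre]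

lemma IsCriticalOfDim.isIso_map (h : d.IsCriticalOfDim α M) {N : C} (f : N ⟶ M) [Mono f]
    (hN : ¬ IsZero N) : IsIso (L.map f) :=
  Localization.inverts L (d.lt α).isoModSerre f
    ((d.lt α).isoModSerre_of_mono f (h.dim_cokernel_lt f hN))

/-- Subobjects in the quotient lift to subobjects of `M`; the nonzero ones have cokernel in
`C_{<α}`, hence become everything. -/
lemma IsCriticalOfDim.simple_localization [Preadditive D] [L.Additive]
    (h : d.IsCriticalOfDim α M) : Simple (L.obj M) where
  mono_isIso_iff_nonzero {Y} g hg := by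
    constructor
    · intro hiso h0
      have h1 : IsZero (L.obj M) := by
        rw [IsZero.iff_id_eq_zero, ← cancel_epi g, h0, zero_comp, zero_comp]
      exact ((isZero_obj_iff L (d.lt α) M).1 h1).ne h.1
    · intro h0
      obtain ⟨Z, i, _, e, he⟩ := exists_iso_of_mono_localization L (d.lt α) g
      have hZ : ¬ IsZero Z := fun hZ => h0 (by
        rw [← cancel_epi e.hom, he, hZ.eq_of_src i 0, L.map_zero, comp_zero])
      have := h.isIso_map L i hZ
      rw [← he] at this
      exact IsIso.of_isIso_comp_left e.hom g

lemma IsCriticalOfDim.isTiny_iff (h : d.IsCriticalOfDim α M) :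
    d.IsTiny M ↔ IsTinyObject ((d.lt α).isoModSerre.Q.obj M) := by
  refine ⟨fun ⟨β, hβ, hβ'⟩ => ?_, fun h' => ⟨α, h, h'⟩⟩
  obtain rfl := h.eq_of_common hβ (𝟙 M) (𝟙 M) h.not_isZero
  exact hβ'

lemma IsCriticalOfDim.isTiny_of_common (h : d.IsCriticalOfDim α M) {M' N : C} {β : Ordinal.{t}}
    (h' : d.IsCriticalOfDim β M') (f : N ⟶ M) (g : N ⟶ M') [Mono f] [Mono g]
    (hN : ¬ IsZero N) (hM : d.IsTiny M) : d.IsTiny M' := by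
  obtain rfl := h.eq_of_common h' f g hN
  rw [h.isTiny_iff] at hM
  rw [h'.isTiny_iff]
  have := h.isIso_map (d.lt α).isoModSerre.Q f hN
  have := h'.isIso_map (d.lt α).isoModSerre.Q g hN
  exact isTinyObject_of_iso ((asIso ((d.lt α).isoModSerre.Q.map f)).symm ≪≫
    asIso ((d.lt α).isoModSerre.Q.map g)) hM

variable (Z : ObjectProperty C) [IsWeaklyClosed Z] {O : Z.FullSubcategory}

lemma restrict_isCriticalOfDim_iff :
    (d.restrict Z).IsCriticalOfDim α O ↔ d.IsCriticalOfDim α O.obj := by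
  have := Z.preservesCokernels_ι
  constructor
  · intro h
    refine isCriticalOfDim_of_forall_mono h.1 fun N f _ hN => ?_
    let N' : Z.FullSubcategory := ⟨N, Z.prop_of_mono f O.property⟩
    let f' : N' ⟶ O := Z.homMk f
    have : Mono f' := Z.ι.mono_of_mono_map (f := f') (inferInstanceAs (Mono f))
    have h1 := h.dim_cokernel_lt f' (fun h0 => hN (Z.ι.map_isZero h0))
    exact (d.dim_congr (PreservesCokernel.iso Z.ι f')).symm.trans_lt h1
  · intro h
    refine isCriticalOfDim_of_forall_mono h.1 fun N f _ hN => ?_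
    have h1 := h.dim_cokernel_lt f.hom (fun h0 => hN (by
      rw [IsZero.iff_id_eq_zero] at h0 ⊢
      ext
      exact h0))
    exact (d.dim_congr (PreservesCokernel.iso Z.ι f)).trans_lt h1

end Critical

section Comparison

variable {C : Type u} [Category.{v} C] [Abelian C] {d : DimensionFunction.{t} C}
  {α : Ordinal.{t}} (Z : ObjectProperty C) [IsWeaklyClosed Z]

variable (d α) in
/-- The functor between the quotient categories induced by the inclusion of a weakly closed
subspace. -/
lemma exists_localization_functor :
    ∃ (F : ((d.restrict Z).lt α).isoModSerre.Localization ⥤ (d.lt α).isoModSerre.Localization)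
      (_ : F.Additive) (_ : F.Full) (_ : F.Faithful) (_ : F.PreservesMonomorphisms),
      Nonempty (((d.restrict Z).lt α).isoModSerre.Q ⋙ F ≅ Z.ι ⋙ (d.lt α).isoModSerre.Q) ∧
      ∀ X, IsNoetherianObject (F.obj X) ↔ IsNoetherianObject X := by
  have hT (M : Z.FullSubcategory) : (d.restrict Z).lt α M ↔ d.lt α M.obj := Iff.rfl
  have hinv : ((d.restrict Z).lt α).isoModSerre.IsInvertedBy
      (Z.ι ⋙ (d.lt α).isoModSerre.Q) := fun X Y f hf =>
    Localization.inverts (d.lt α).isoModSerre.Q (d.lt α).isoModSerre _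
      ((isoModSerre_restrict Z (d.lt α) _ hT f).1 hf)
  let LZ := ((d.restrict Z).lt α).isoModSerre.Q
  let L := (d.lt α).isoModSerre.Q
  let F := Localization.lift (Z.ι ⋙ L) hinv LZ
  let e : LZ ⋙ F ≅ Z.ι ⋙ L := Localization.fac _ _ _
  have h1 := additive_of_localization Z ((d.restrict Z).lt α) LZ L F e
  have h2 := full_of_localization Z (d.lt α) ((d.restrict Z).lt α) LZ L F e hT
  have h3 := faithful_of_localization Z (d.lt α) ((d.restrict Z).lt α) LZ L F e hT
  have h4 := preservesMonomorphisms_of_localization Z (d.lt α) ((d.restrict Z).lt α) LZ L F e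
  exact ⟨F, h1, h2, h3, h4, ⟨e⟩, fun X => ⟨isNoetherianObject_of_map F,
    isNoetherianObject_map F fun Y g _ =>
      exists_iso_of_mono_restrict Z (d.lt α) ((d.restrict Z).lt α) LZ L F e g h2 h3⟩⟩

variable {Z}

lemma isTinyObject_restrict {O : Z.FullSubcategory}
    (h : IsTinyObject ((d.lt α).isoModSerre.Q.obj O.obj)) :
    IsTinyObject (((d.restrict Z).lt α).isoModSerre.Q.obj O) := by
  obtain ⟨F, _, _, _, _, ⟨e⟩, hF⟩ := exists_localization_functor d α Z
  intro N hN
  rw [finite_hom_map_iff F]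
  exact finite_hom_of_iso (Iso.refl _) (e.app O).symm (h _ ((hF N).2 hN))

/-- If the image of `N` in the quotient category is noetherian, it is the image of some term of
a given exhaustive filtration of `N`. -/
lemma exists_isoModSerre_filtration [IsGrothendieckAbelian.{v} C] (T : ObjectProperty C)
    [hT : IsLocalizing T] {N : C}
    (hN : IsNoetherianObject (T.isoModSerre.Q.obj N)) (G : ℕ →o Subobject N)
    (hG : IsLUB (Set.range G) ⊤) : ∃ n, T.isoModSerre (G n).arrow := by
  have := preservesMonomorphisms T.isoModSerre.Q T
  let φ : ℕ →o Subobject (T.isoModSerre.Q.obj N) :=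
    ⟨fun n => Subobject.mk (T.isoModSerre.Q.map (G n).arrow), fun m n h =>
      Subobject.mk_le_mk_of_comm (T.isoModSerre.Q.map (Subobject.ofLE _ _ (G.monotone h))) (by
        rw [← Functor.map_comp, Subobject.ofLE_arrow])⟩
  -- The chain stabilizes in the quotient, so `G m / G n` is torsion for all `m ≥ n`. The largest
  -- torsion subobject of `N / G n` contains all of these, hence is the whole of `N / G n`.
  obtain ⟨n, hn⟩ := monotone_chain_condition_of_isNoetherianObject φ
  refine ⟨n, T.isoModSerre_of_mono _ ?_⟩
  obtain ⟨A, hA, hA'⟩ := exists_largest_subobject T hT.closedUnderCoproducts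
    (cokernel (G n).arrow)
  have hm (m : ℕ) (hnm : n ≤ m) : T (cokernel (Subobject.ofLE _ _ (G.monotone hnm))) := by
    have h1 := (hn m hnm).ge
    let a := Subobject.ofMkLEMk _ _ h1
    have ha : a ≫ T.isoModSerre.Q.map (G n).arrow = T.isoModSerre.Q.map (G m).arrow :=
      Subobject.ofMkLEMk_comp h1
    have h2 : Epi (T.isoModSerre.Q.map (Subobject.ofLE _ _ (G.monotone hnm))) := by
      refine (epi_of_epi_fac (f := a) (h := 𝟙 _) ?_ :)
      rw [← cancel_mono (T.isoModSerre.Q.map (G m).arrow), Category.assoc, ← Functor.map_comp,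
        Subobject.ofLE_arrow, ha, Category.id_comp]
    exact (epi_map_iff T.isoModSerre.Q T _).1 h2
  have hle (m : ℕ) (hnm : n ≤ m) : G m ≤ (Subobject.pullback (cokernel.π (G n).arrow)).obj A := by
    refine Subobject.le_of_factors ?_
    rw [pullback_factors_iff]
    have h1 : Subobject.ofLE _ _ (G.monotone hnm) ≫ (G m).arrow ≫ cokernel.π (G n).arrow = 0 := by
      rw [← Category.assoc, Subobject.ofLE_arrow, cokernel.condition]
    rw [← cokernel.π_desc _ _ h1]
    exact Subobject.factors_of_factors_right _ (hA' _ _ (hm m hnm))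
  have htop : (Subobject.pullback (cokernel.π (G n).arrow)).obj A = ⊤ := by
    rw [← top_le_iff]
    refine hG.2 ?_
    rintro _ ⟨m, rfl⟩
    exact (G.monotone (le_max_right n m)).trans (hle _ (le_max_left n m))
  have h1 : A.Factors (cokernel.π (G n).arrow) := by
    have := (pullback_factors_iff (cokernel.π (G n).arrow) A (𝟙 N)).1 (by
      rw [htop]; exact Subobject.top_factors _)
    rwa [Category.id_comp] at this
  have h2 : Epi A.arrow := epi_of_epi_fac (A.factorThru_arrow _ h1)
  exact T.prop_of_epi A.arrow hA

lemma isTinyObject_of_restrict [IsGrothendieckAbelian.{v} C] (hα : IsLocalizing (d.lt α))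
    (hZ : ∀ M : C, IsSupportedAt Z M) {O : Z.FullSubcategory}
    (hO : d.IsCriticalOfDim α O.obj)
    (h : IsTinyObject (((d.restrict Z).lt α).isoModSerre.Q.obj O)) :
    IsTinyObject ((d.lt α).isoModSerre.Q.obj O.obj) := by
  obtain ⟨F, _, _, _, _, ⟨e⟩, hF⟩ := exists_localization_functor d α Z
  let L := (d.lt α).isoModSerre.Q
  have hsimple : Simple (L.obj O.obj) := hO.simple_localization L
  have := Localization.essSurj L (d.lt α).isoModSerre
  -- The lift `N` need not be noetherian in `C`, only its image is; the filtration is therefore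
  -- applied to `N` and truncated in the quotient.
  have key (N : C) (hN : IsNoetherianObject (L.obj N)) :
      Module.Finite (End (L.obj O.obj)) (L.obj N ⟶ L.obj O.obj) := by
    obtain ⟨G, hG₀, hG, hGZ⟩ := hZ N
    have hfin (k : ℕ) : Module.Finite (End (L.obj O.obj)) (L.obj (G k : C) ⟶ L.obj O.obj) := by
      induction k with
      | zero =>
        have h0 : IsZero (L.obj (G 0 : C)) := by
          refine L.map_isZero ?_
          rw [← subobject_eq_bot_iff_isZero, hG₀]
        have : Subsingleton (L.obj (G 0 : C) ⟶ L.obj O.obj) := ⟨fun a b => h0.eq_of_src a b⟩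
        infer_instance
      | succ k hk =>
        let i := Subobject.ofLE _ _ (G.monotone k.le_succ)
        let Y : Z.FullSubcategory := ⟨cokernel i, hGZ k⟩
        have hY : IsNoetherianObject (L.obj (cokernel i)) :=
          isNoetherianObject_localization_of_epi L (d.lt α) (cokernel.π i)
            (isNoetherianObject_localization_of_mono L (d.lt α) (G (k + 1)).arrow hN)
        have hY' : IsNoetherianObject (((d.restrict Z).lt α).isoModSerre.Q.obj Y) := by
          rw [← hF]
          have : IsNoetherianObject ((Z.ι ⋙ (d.lt α).isoModSerre.Q).obj Y) := hY
          exact isNoetherianObject_of_mono (e.hom.app Y)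
        refine finite_hom_localization_of_shortExact L (d.lt α)
          (S := ShortComplex.mk i (cokernel.π i) (by simp))
          (ShortComplex.ShortExact.mk (ShortComplex.exact_cokernel i)) _ hk ?_
        exact finite_hom_of_iso (e.app Y) (e.app O) ((finite_hom_map_iff F _ _).1 (h _ hY'))
    obtain ⟨n, hn⟩ := exists_isoModSerre_filtration (d.lt α) hN G hG
    have := Localization.inverts L (d.lt α).isoModSerre _ hn
    exact finite_hom_of_iso (asIso (L.map (G n).arrow)) (Iso.refl _) (hfin n)
  intro N hN
  refine finite_hom_of_iso (L.objObjPreimageIso N) (Iso.refl _) (key _ ?_)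
  exact isNoetherianObject_of_mono (L.objObjPreimageIso N).hom

end Comparison

end DimensionFunction

/-! ### Saturation and the reduced subspace -/

section Sigma

variable {C : Type u} [Category.{v} C]

lemma sigma_of_mono {A B N : C} (f : A ⟶ B) [Mono f] (h : sigma A N) : sigma B N :=
  fun P hP hB => h P hP (P.prop_of_mono f hB)

lemma sigma_self (A : C) : sigma A A := fun _ _ h => h

end Sigma

section Saturation

variable {C : Type u} [Category.{v} C] [Abelian C] [IsGrothendieckAbelian.{v} C]

/-- If `P` is weakly closed, `A ≤ M` is contained in some `B` such that `B / A` is the largest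
subobject of `M / A` in `P`. -/
lemma exists_next_subobject (P : ObjectProperty C) [hP : IsWeaklyClosed P] {M : C}
    (A : Subobject M) : ∃ (B : Subobject M) (h : A ≤ B), P (cokernel (Subobject.ofLE A B h)) ∧
      ∀ (K K' : C) (f : K' ⟶ M) (a : K' ⟶ K) (b : K ⟶ cokernel A.arrow),
        f ≫ cokernel.π A.arrow = a ≫ b → P K → B.Factors f := by
  obtain ⟨T, hT, hT'⟩ := exists_largest_subobject P hP.closedUnderCoproducts (cokernel A.arrow)
  let B := (Subobject.pullback (cokernel.π A.arrow)).obj T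
  have hAB : A ≤ B := by
    refine Subobject.le_of_factors ?_
    rw [pullback_factors_iff, cokernel.condition]
    exact Subobject.factors_zero
  refine ⟨B, hAB, ?_, fun K K' f a b h hK => ?_⟩
  · obtain ⟨f, _⟩ := exists_mono_cokernel (Subobject.ofLE A B hAB) B.arrow
      (Subobject.ofLE_arrow hAB) T ((pullback_factors_iff _ _ _).1 (Subobject.factors_self _))
    exact P.prop_of_mono f hT
  · rw [pullback_factors_iff, h]
    exact Subobject.factors_of_factors_right _ (hT' _ _ hK)

/-- In a locally noetherian category, if every nonzero object has a nonzero subobject in a weakly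
closed subspace, every object is supported there. -/
lemma isSupportedAt_of_forall_exists (hC : IsLocallyNoetherian C) (P : ObjectProperty C)
    [IsWeaklyClosed P]
    (hP : ∀ M : C, ¬ IsZero M → ∃ (K : C) (i : K ⟶ M), Mono i ∧ ¬ IsZero K ∧ P K) (M : C) :
    IsSupportedAt P M := by
  choose next hle hnext hfac using exists_next_subobject P (M := M)
  let F : ℕ → Subobject M := fun n => Nat.rec ⊥ (fun _ A => next A) n
  have hF : Monotone F := monotone_nat_of_le_succ fun n => hle (F n)
  refine ⟨⟨F, hF⟩, rfl, ⟨fun _ _ => le_top, fun U hU => ?_⟩, fun n => hnext (F n)⟩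
  obtain ⟨ι, G, hG, hsep⟩ := hC
  have hU0 : cokernel.π U.arrow = 0 := by
    refine hsep _ _ fun Y hY h => ?_
    obtain ⟨i, rfl⟩ := (ObjectProperty.ofObj_iff _ _).1 hY
    have := hG i
    -- The preimages of the `F n` in a noetherian generator stabilize; every `h` from it must then
    -- land in `F n`.
    obtain ⟨n, hn⟩ := monotone_chain_condition_of_isNoetherianObject
      (⟨fun n => (Subobject.pullback h).obj (F n),
        fun a b hab => (Subobject.pullback h).monotone (hF hab)⟩ : ℕ →o Subobject (G i))
    have hn' : (Subobject.pullback h).obj (F n) = (Subobject.pullback h).obj (F (n + 1)) :=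
      hn (n + 1) n.le_succ
    rw [comp_zero, ← factors_iff_comp_cokernel_eq_zero]
    refine Subobject.factors_of_le _ (hU ⟨n, rfl⟩) ?_
    change (F n).Factors h
    rw [factors_iff_comp_cokernel_eq_zero]
    by_contra hne
    let q := h ≫ cokernel.π (F n).arrow
    obtain ⟨K, k, _, hK, hPK⟩ := hP (Abelian.image q) (fun h0 => hne (by
      change q = 0
      rw [← Abelian.image.fac q, h0.eq_of_src (Abelian.image.ι q) 0, comp_zero]))
    -- `r` is the part of the generator mapping into `K ≤ M / F n`. As `K` is in `P`, it lands in `F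
    -- (n + 1)`, hence by stability in `F n`, which makes `K` zero.
    let r := pullback.fst (Abelian.factorThruImage q) k
    have hr : r ≫ h ≫ cokernel.π (F n).arrow = pullback.snd _ _ ≫ k ≫ Abelian.image.ι q := by
      rw [← pullback.condition_assoc]
      exact congrArg (r ≫ ·) (Abelian.image.fac q).symm
    have h1 : (F (n + 1)).Factors (r ≫ h) :=
      hfac (F n) _ _ (r ≫ h) _ _ ((Category.assoc _ _ _).trans hr) hPK
    rw [← pullback_factors_iff, ← hn', pullback_factors_iff, factors_iff_comp_cokernel_eq_zero,
      Category.assoc, hr] at h1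
    apply hK
    rw [IsZero.iff_id_eq_zero, ← cancel_mono (k ≫ Abelian.image.ι q),
      ← cancel_epi (pullback.snd (Abelian.factorThruImage q) k)]
    simpa using h1
  have : Epi U.arrow := Preadditive.epi_of_cokernel_zero hU0
  rw [top_le_iff, ← Subobject.isIso_arrow_iff_eq_top]
  exact isIso_of_mono_of_epi _

lemma isSupportedAt_reduced (hC : IsLocallyNoetherian C) (h : HasEnoughPrimes C) (M : C) :
    IsSupportedAt (reduced C) M := by
  refine isSupportedAt_of_forall_exists hC _ (fun M hM => ?_) M
  obtain ⟨N, hN⟩ := h M hM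
  exact ⟨N, N.arrow, inferInstance, hN.1, fun P _ hP => hP _ hN⟩

lemma sigma_obj (Z : ObjectProperty C) [hZ : IsWeaklyClosed Z] {A B : Z.FullSubcategory}
    (h : sigma A B) : sigma A.obj B.obj := by
  intro P hP hA
  refine h (P.inverseImage Z.ι) ?_ hA
  exact
    { prop_of_mono := fun f _ h => P.prop_of_mono f.hom h
      prop_of_epi := fun f _ h => P.prop_of_epi f.hom h
      closedUnderCoproducts := fun ι => ⟨by
        rintro N ⟨⟨F, c, hc⟩, hF⟩
        have := hZ.closedUnderCoproducts ι
        have := hP.closedUnderCoproducts ι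
        exact P.prop_of_isColimit (isColimitOfPreserves Z.ι hc) hF⟩ }

end Saturation

/-! ### Points and their extensions -/

namespace DimensionFunction

variable {C : Type u} [Category.{v} C] [Abelian C] {d : DimensionFunction.{t} C}

lemma IsSpectralPair.exists_isCriticalOfDim {Z : ObjectProperty C} [IsWeaklyClosed Z]
    {E : Z.FullSubcategory} {O : Subobject E} (h : (d.restrict Z).IsSpectralPair E O) :
    ∃ α, d.IsCriticalOfDim α (O : Z.FullSubcategory).obj := by
  obtain ⟨α, hα⟩ := h.largestCritical.1
  exact ⟨α, (restrict_isCriticalOfDim_iff Z).1 hα⟩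

variable [IsGrothendieckAbelian.{v} C]

/-- The extension of a weak point may be computed using any representative. -/
lemma extension_eq_sigma
    (hd : ∀ (α : Ordinal.{t}) (M : C), d.IsCriticalOfDim α M → IsLocalizing (d.lt α))
    {Z : ObjectProperty C} [IsWeaklyClosed Z] {E : Z.FullSubcategory} {O : Subobject E}
    (h : (d.restrict Z).IsSpectralPair E O) {E' : C}
    {j : (O : Z.FullSubcategory).obj ⟶ E'} (hj : IsInjectiveHull j) {O' : Subobject E'}
    (hO' : d.IsLargestCritical O') :
    d.extension Z (sigma (O : Z.FullSubcategory)) = sigma (O' : C) := by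
  ext N
  refine ⟨?_, fun hN => ⟨E, O, E', j, O', h, rfl, hj, hO', hN⟩⟩
  rintro ⟨E₁, O₁, E₁', j₁, O₁', h₁, hσ, hj₁, hO₁', hN⟩
  obtain ⟨α, hα⟩ := h.exists_isCriticalOfDim
  obtain ⟨β, hβ⟩ := h₁.exists_isCriticalOfDim
  -- A common submodule `R` of two representatives embeds one largest critical submodule in the
  -- other. Only one inclusion is needed, since `O` is itself a representative.
  obtain ⟨R, a, b, _, _, hR⟩ := exists_common_of_sigma hd ⟨β, hβ⟩ ⟨α, hα⟩
    (sigma_obj Z (by rw [hσ]; exact sigma_self _)) (sigma_obj Z (by rw [← hσ]; exact sigma_self _))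
  have := hj.mono
  obtain ⟨k, _⟩ := hO₁'.exists_mono_of_common hβ hj₁ a hR hj.injective hO' (b ≫ j)
  exact sigma_of_mono k hN

/-- Tininess of a critical object of a weakly closed subspace may be tested on the largest
critical subobject of its injective hull in the ambient space. -/
lemma isTiny_restrict_iff
    (hd : ∀ (α : Ordinal.{t}) (M : C), d.IsCriticalOfDim α M → IsLocalizing (d.lt α))
    {Z : ObjectProperty C} [IsWeaklyClosed Z] (hZ : ∀ M : C, IsSupportedAt Z M)
    {O : Z.FullSubcategory} {α : Ordinal.{t}} (hO : d.IsCriticalOfDim α O.obj) {E' : C}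
    {j : O.obj ⟶ E'} (hj : IsInjectiveHull j) {O' : Subobject E'} (hO' : d.IsLargestCritical O') :
    (d.restrict Z).IsTiny O ↔ d.IsTiny (O' : C) := by
  obtain ⟨hO'α, k, _, -⟩ := hO'.exists_mono hO hj
  have h1 : d.IsTiny O.obj ↔ d.IsTiny (O' : C) :=
    ⟨hO.isTiny_of_common hO'α (𝟙 _) k hO.not_isZero,
      hO'α.isTiny_of_common hO k (𝟙 _) hO.not_isZero⟩
  rw [← h1, hO.isTiny_iff, ((restrict_isCriticalOfDim_iff Z).2 hO).isTiny_iff]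
  exact ⟨isTinyObject_of_restrict (hd α _ hO) hZ hO, isTinyObject_restrict⟩

lemma isPoint_iff_isPoint_extension
    (hd : ∀ (α : Ordinal.{t}) (M : C), d.IsCriticalOfDim α M → IsLocalizing (d.lt α))
    (Z : ObjectProperty C) [IsWeaklyClosed Z] (hZ : ∀ M : C, IsSupportedAt Z M)
    (W : ObjectProperty Z.FullSubcategory) (hW : (d.restrict Z).IsWeakPoint W) :
    (d.restrict Z).IsPoint W ↔ d.IsPoint (d.extension Z W) := by
  constructor
  · rintro ⟨E, O, h, htiny, rfl⟩
    obtain ⟨α, hα⟩ := h.exists_isCriticalOfDim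
    obtain ⟨E', j, hj⟩ := exists_injectiveHull (O : Z.FullSubcategory).obj
    obtain ⟨O', hO'⟩ := hα.exists_largestCritical hj (hd α _ hα)
    exact ⟨E', O', ⟨hj.injective, hα.hull_indecomposable hj, hO'⟩,
      (isTiny_restrict_iff hd hZ hα hj hO').1 htiny, extension_eq_sigma hd h hj hO'⟩
  · rintro ⟨E₂, O₂, h₂, htiny, hσ⟩
    obtain ⟨E, O, h, rfl⟩ := hW
    obtain ⟨α, hα⟩ := h.exists_isCriticalOfDim
    obtain ⟨E', j, hj⟩ := exists_injectiveHull (O : Z.FullSubcategory).obj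
    obtain ⟨O', hO'⟩ := hα.exists_largestCritical hj (hd α _ hα)
    rw [extension_eq_sigma hd h hj hO'] at hσ
    obtain ⟨β, hβ⟩ : d.IsCritical (O₂ : C) := h₂.largestCritical.1
    obtain ⟨γ, hγ⟩ : d.IsCritical (O' : C) := hO'.1
    -- The tiny representative `O₂` of the extension need not come from `Z`; a common submodule
    -- carries its tininess over to `O'`.
    obtain ⟨R, a, b, _, _, hR⟩ := exists_common_of_sigma hd ⟨β, hβ⟩ ⟨γ, hγ⟩
      (by rw [hσ]; exact sigma_self _) (by rw [← hσ]; exact sigma_self _)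
    exact ⟨E, O, h, (isTiny_restrict_iff hd hZ hα hj hO').2
      (hβ.isTiny_of_common hγ a b hR htiny), rfl⟩

end DimensionFunction

end NCSpace

open NCSpace
theorem mainTheorem10 {C : Type u} [Category.{v} C] [Abelian C] [IsGrothendieckAbelian.{v} C]
    (hC : IsLocallyNoetherian C) (d : DimensionFunction.{t} C)
    (hd : ∀ (α : Ordinal.{t}) (M : C), d.IsCriticalOfDim α M → IsLocalizing (d.lt α)) :
    (∀ (Z : ObjectProperty C) [IsWeaklyClosed Z], (∀ M : C, IsSupportedAt Z M) →
      ∀ W : ObjectProperty Z.FullSubcategory, (d.restrict Z).IsWeakPoint W →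
        ((d.restrict Z).IsPoint W ↔ d.IsPoint (d.extension Z W))) ∧
    (HasEnoughPrimes C →
      (∀ M : C, IsSupportedAt (reduced C) M) ∧
      ∀ W : ObjectProperty (reduced C).FullSubcategory,
        (d.restrict (reduced C)).IsWeakPoint W →
          ((d.restrict (reduced C)).IsPoint W ↔ d.IsPoint (d.extension (reduced C) W))) := by
  refine ⟨fun Z _ hZ W hW => DimensionFunction.isPoint_iff_isPoint_extension hd Z hZ W hW,
    fun h => ⟨isSupportedAt_reduced hC h, fun W hW => ?_⟩⟩
  exact DimensionFunction.isPoint_iff_isPoint_extension hd _ (isSupportedAt_reduced hC h) W hW
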